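/- Let $N\ge 1$, $p>1$, $\gamma<1$, $0<\sigma\le 1$, $0\le\eta\le 1$, $\mu\in\mathbb{R}$, and consider $$u_{tt}+(-\Delta)^\sigma u+\mu(-\Delta)^\eta u_t={}_0I_t^{1-\gamma}(|u|^p)\ \text{ in }(0,T)\times\mathbb{R}^N,\qquad u(0,x)=u_0(x),\quad u_t(0,x)=u_1(x), \tag{1}$$ where ${}_0I_t^{\alpha}f(t)=\frac1{\Gamma(\alpha)}\int_0^t (t-s)^{\alpha-1}f(s)\,ds$ and, for $0<s<1$, $$(-\Delta)^s\psi(x)=\frac{s2^{2s-1}\Gamma(\frac{N+2s}{2})}{\pi^{N/2}\Gamma(1-s)}\int_{\mathbb{R}^N}\frac{2\psi(x)-\psi(x+y)-\psi(x-y)}{|y|^{N+2s}}\,dy,$$ while $(-\Delta)^0\psi=\psi$ and $(-\Delta)^1\psi=-\Delta\psi$. For finite $T>0$, a real function $u$ is a weak solution of (1) on $(0,T)$ if $(1+|x|)^{-N-2\eta}u_0\in L^1(\mathbb{R}^N)$, $u_1\in L^1_{loc}(\mathbb{R}^N)$, $u\in L^p((0,T),L^p_{loc}(\mathbb{R}^N))$,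 $(1+|x|)^{-N-2\min\{\eta,\sigma\}}u\in L^1((0,T),L^1(\mathbb{R}^N))$, and $$\int_{\mathbb{R}^N}\!\int_0^T\big[{}_0I_t^{1-\gamma}(|u|^p)\varphi+(u_0+tu_1)\varphi_{tt}+\mu u_0(-\Delta)^\eta(-\varphi_t)\big]dt\,dx=\int_{\mathbb{R}^N}\!\int_0^T u(-\Delta)^\sigma\varphi\,dt\,dx+\int_{\mathbb{R}^N}\!\int_0^T u\big[\varphi_{tt}+\mu(-\Delta)^\eta(-\varphi_t)\big]dt\,dx$$ for all $\varphi(t,x)=\psi(x)\phi(t)$ with $\psi\in C_0^\infty(\mathbb{R}^N)$, $\phi\in C^2([0,T])$, $\phi(T)=\phi'(T)=0$. For $T=+\infty$, $u$ is a (global) weak solution if it is a weak solution on $(0,T')$ for every finite $T'>0$. Let $\chi(x)=\big(\int_{\mathbb{R}^N}(1+|y|^2)^{-q/2}dy\big)^{-1}(1+|x|^2)^{-q/2}$, where $q>N$, and in addition $q\le N+2\sigma$ if $0<\sigma<1$, and $q\le N+2\eta$ if $0<\eta<1$. Theorem. Let $u_0\chi,\,u_1\chi\in L^1(\mathbb{R}^N)$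 and $0<T\le+\infty$. Let $u$ be a weak solution of (1) on $(0,T)$ that is nontrivial (not a.e. zero on $(0,T)\times\mathbb{R}^N$) and satisfies $|u|^p\chi\in L^1_{loc}([0,T),L^1(\mathbb{R}^N))$. If $p\gamma\le 1$, then $T<+\infty$; that is, there is no nontrivial global weak solution with $|u|^p\chi\in L^1_{loc}([0,\infty),L^1(\mathbb{R}^N))$. -/

import Mathlib

open MeasureTheory Set
open scoped ContDiff

noncomputable section

/-- The left-sided Riemann-Liouville fractional integral `₀I_t^α f (t)` of order `α > 0`. -/
def leftFracIntegral (α : ℝ) (f : ℝ → ℝ) (t : ℝ) : ℝ :=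
  (Real.Gamma α)⁻¹ * ∫ s in (0 : ℝ)..t, f s / (t - s) ^ (1 - α)

/-- The fractional Laplacian `(-Δ)^s` for `0 ≤ s ≤ 1`: the identity for `s = 0`, minus the
Laplacian for `s = 1`, and the singular integral of second differences for `0 < s < 1`. -/
def fracLaplacian {N : ℕ} (s : ℝ) (f : EuclideanSpace ℝ (Fin N) → ℝ)
    (x : EuclideanSpace ℝ (Fin N)) : ℝ :=
  if s = 0 then f x
  else if s = 1 then -(Laplacian.laplacian f x)
  else
    s * 2 ^ (2 * s - 1) * Real.Gamma (((N : ℝ) + 2 * s) / 2) /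
        (Real.pi ^ ((N : ℝ) / 2) * Real.Gamma (1 - s)) *
      ∫ y : EuclideanSpace ℝ (Fin N), (2 * f x - f (x + y) - f (x - y)) / ‖y‖ ^ ((N : ℝ) + 2 * s)

/-- The weight `χ(x) = (∫ (1 + |y|²)^{-q/2} dy)⁻¹ (1 + |x|²)^{-q/2}`. -/
def decayWeight (N : ℕ) (q : ℝ) (x : EuclideanSpace ℝ (Fin N)) : ℝ :=
  (∫ y : EuclideanSpace ℝ (Fin N), (1 + ‖y‖ ^ 2) ^ (-q / 2))⁻¹ * (1 + ‖x‖ ^ 2) ^ (-q / 2)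

/-- The decay exponents `q` admitted in the weight: `q > N`, with `q ≤ N + 2σ` if `(-Δ)^σ` is
nonlocal and `q ≤ N + 2η` if `(-Δ)^η` is nonlocal. -/
def AdmissibleDecay (N : ℕ) (σ η q : ℝ) : Prop :=
  (N : ℝ) < q ∧ (0 < σ → σ < 1 → q ≤ N + 2 * σ) ∧ (0 < η → η < 1 → q ≤ N + 2 * η)

/-- `u` is a weak solution on `(0, T) × ℝ^N`, for a finite `T > 0`, of
`u_tt + (-Δ)^σ u + μ (-Δ)^η u_t = ₀I_t^{1-γ}(|u|^p)`, `u(0) = u₀`, `u_t(0) = u₁`.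
The test functions are the products `ψ(x) φ(t)`; primes of `φ` are one-sided at the endpoints
of `[0, T]`. -/
structure IsWeakSolutionOn {N : ℕ} (σ η μ γ p : ℝ) (u₀ u₁ : EuclideanSpace ℝ (Fin N) → ℝ)
    (T : ℝ) (u : ℝ → EuclideanSpace ℝ (Fin N) → ℝ) : Prop where
  data_zero : Integrable (fun x => (1 + ‖x‖) ^ (-(N : ℝ) - 2 * η) * u₀ x)
  data_one : LocallyIntegrable u₁
  memLp_loc : ∀ K : Set (EuclideanSpace ℝ (Fin N)), IsCompact K →
    MemLp (fun z : ℝ × EuclideanSpace ℝ (Fin N) => u z.1 z.2) (ENNReal.ofReal p)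
      (volume.restrict (Ioo 0 T ×ˢ K))
  integrable_weighted :
    Integrable (fun z : ℝ × EuclideanSpace ℝ (Fin N) =>
        (1 + ‖z.2‖) ^ (-(N : ℝ) - 2 * min η σ) * u z.1 z.2)
      (volume.restrict (Ioo 0 T ×ˢ univ))
  weak_form : ∀ (ψ : EuclideanSpace ℝ (Fin N) → ℝ) (φ φ' φ'' : ℝ → ℝ),
    ContDiff ℝ ∞ ψ → HasCompactSupport ψ →
    ContDiffOn ℝ 2 φ (Icc 0 T) →
    φ' = derivWithin φ (Icc 0 T) → φ'' = derivWithin φ' (Icc 0 T) →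
    φ T = 0 → φ' T = 0 →
    ∫ x, ∫ t in (0 : ℝ)..T,
        (leftFracIntegral (1 - γ) (fun s => |u s x| ^ p) t * (ψ x * φ t)
          + (u₀ x + t * u₁ x) * (ψ x * φ'' t)
          + μ * u₀ x * (fracLaplacian η ψ x * (-φ' t)))
      = (∫ x, ∫ t in (0 : ℝ)..T, u t x * (fracLaplacian σ ψ x * φ t))
        + ∫ x, ∫ t in (0 : ℝ)..T,
            u t x * (ψ x * φ'' t + μ * (fracLaplacian η ψ x * (-φ' t)))

/-- Weak solutions with life span `T ∈ (0, ∞]`; for `T = ∞` (a global weak solution) `u` is a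
weak solution on `(0, T')` for every finite `T' > 0`. -/
def IsWeakSolution {N : ℕ} (σ η μ γ p : ℝ) (u₀ u₁ : EuclideanSpace ℝ (Fin N) → ℝ)
    (T : EReal) (u : ℝ → EuclideanSpace ℝ (Fin N) → ℝ) : Prop :=
  (∀ T' : ℝ, T = (T' : EReal) → IsWeakSolutionOn σ η μ γ p u₀ u₁ T' u) ∧
  (T = ⊤ → ∀ T' : ℝ, 0 < T' → IsWeakSolutionOn σ η μ γ p u₀ u₁ T' u)

end

/-! The equation is tested with ψ_n(x)(T-t)^{k+2}, with no rescaling in x as T grows. The ψ_n are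
compactly supported, dominate cχ on |x| ≤ 2^n and satisfy |(-Δ)^s ψ_n| ≤ Cχ for s = 0, σ, η, with c
and C independent of n (`exists_test_functions`). Tonelli and a Beta integral turn the memory term
into a positive multiple of ∫∫|u|^p ψ_n (T-t)^β, where β = k+3-γ (`leftFracIntegral_mul_pow`). All
other terms are at most a constant times T^{k+2}(∫∫|u|χ(1-t/T)^{β/p} + D), where D is the weighted
mass of the data; the signs of μ and of the data play no role. Dividing by T^β and letting n → ∞
gives, for T ≥ 1 (`exists_energy_estimate`), E(T) := ∫∫|u|^p χ(1-t/T)^β ≤ C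
T^{-(1-γ)}(∫∫|u|χ(1-t/T)^{β/p} + D).

The condition pγ ≤ 1 says exactly that 1-γ ≥ 1/p'. Since χ has finite mass, the slab (0,T)×ℝ^N has
χ-volume O(T), and this growth is just compensated by T^{-1/p'} in Young's inequality. So E is
bounded and |u|^p χ is integrable over all times. In a second pass the integral of |u|χ is cut at a
fixed time A: the part before A and the data are killed by T^{-1/p'}, the part after A is governed
by the small tail of ∫∫|u|^p χ. Hence E(T) → 0 and u = 0
(`setIntegral_rpow_eq_zero_of_energy_estimate`). The borderline pγ = 1 needs no separate treatment.

The ψ_n are dyadic sums ∑ 2^{-kq}θ(2^{-k}x), comparable to (1+|x|)^{-q} inside the ball. By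
homogeneity (-Δ)^s contributes an extra 2^{-2sk} to the k-th term, so a decay (1+|x|)^{-M} of (-Δ)^s
θ survives summation if M < q+2s. In the nonlocal case M = N+2s: then q > N gives convergence, and q
≤ N+2s gives domination by χ. -/

/-! ### The fractional Laplacian of test functions -/

/-- Second differences of a compactly supported smooth function are `O(min(1, |y|²))`. -/
theorem exists_second_difference_bound {N : ℕ} {f : EuclideanSpace ℝ (Fin N) → ℝ}
    (hf : ContDiff ℝ ∞ f) (hc : HasCompactSupport f) :
    ∃ C : ℝ, 0 ≤ C ∧ ∀ x y, |2 * f x - f (x + y) - f (x - y)| ≤ C * min 1 (‖y‖ ^ 2) := by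
  have hf' : ContDiff ℝ 1 (fderiv ℝ f) := hf.fderiv_right (by norm_cast)
  obtain ⟨K, hK⟩ := hf'.lipschitzWith_of_hasCompactSupport (hc.fderiv ℝ) one_ne_zero
  obtain ⟨B, hB⟩ := hc.exists_bound_of_continuous hf.continuous
  have hB0 : 0 ≤ B := (norm_nonneg _).trans (hB 0)
  have hd : Differentiable ℝ f := hf.differentiable (by simp)
  refine ⟨2 * K + 4 * B, by positivity, fun x y => ?_⟩
  have h1 : |2 * f x - f (x + y) - f (x - y)| ≤ 4 * B := by
    have a1 := abs_le.1 (hB x)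
    have a2 := abs_le.1 (hB (x + y))
    have a3 := abs_le.1 (hB (x - y))
    rw [abs_le]
    constructor <;> linarith [a1.1, a1.2, a2.1, a2.2, a3.1, a3.2]
  have h2 : |2 * f x - f (x + y) - f (x - y)| ≤ 2 * K * ‖y‖ ^ 2 := by
    -- The symmetric sum has derivative Df(x+z) - Df(x-z), of norm at most 2K|z|; the mean value
    -- inequality on the ball of radius |y| then yields the quadratic bound.
    have hder : ∀ z : EuclideanSpace ℝ (Fin N),
        HasFDerivAt (fun z => f (x + z) + f (x - z))
          (fderiv ℝ f (x + z) - fderiv ℝ f (x - z)) z := by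
      intro z
      have e1 : HasFDerivAt (fun z => f (x + z)) (fderiv ℝ f (x + z)) z := by
        have := (hd (x + z)).hasFDerivAt.comp z ((hasFDerivAt_id z).const_add x)
        simpa [Function.comp_def] using this
      have e2 : HasFDerivAt (fun z => f (x - z)) (-fderiv ℝ f (x - z)) z := by
        have := (hd (x - z)).hasFDerivAt.comp z ((hasFDerivAt_id z).const_sub x)
        simpa [Function.comp_def] using this
      rw [sub_eq_add_neg]
      exact e1.add e2
    have key := Convex.norm_image_sub_le_of_norm_hasFDerivWithin_le
      (hs := convex_closedBall (0 : EuclideanSpace ℝ (Fin N)) ‖y‖)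
      (C := 2 * K * ‖y‖) (x := 0) (y := y) (fun z _ => (hder z).hasFDerivWithinAt) (fun z hz => by
        have := hK.norm_sub_le (x + z) (x - z)
        refine this.trans ?_
        have e : x + z - (x - z) = (2 : ℝ) • z := by rw [two_smul]; abel
        rw [e, norm_smul]
        have : ‖z‖ ≤ ‖y‖ := by simpa using hz
        have hK0 : (0 : ℝ) ≤ K := K.2
        simp only [Real.norm_ofNat]
        nlinarith) (by simp) (by simp)
    have e : 2 * f x - f (x + y) - f (x - y) =
        -((f (x + y) + f (x - y)) - (f (x + 0) + f (x - 0))) := by simp; ring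
    rw [e, abs_neg]
    refine key.trans (le_of_eq ?_)
    simp; ring
  have hK0 : (0 : ℝ) ≤ K := K.2
  rcases le_total 1 (‖y‖ ^ 2) with h | h
  · rw [min_eq_left h]; linarith
  · rw [min_eq_right h]; nlinarith [sq_nonneg ‖y‖]

/-- In polar coordinates the radial density is r^{1-2s} on (0,1), integrable as s < 1, and r^{-1-2s}
beyond, integrable as s > 0. -/
theorem integrable_min_one_sq_div_norm_rpow {N : ℕ} (hN : 1 ≤ N) {s : ℝ} (hs0 : 0 < s)
    (hs1 : s < 1) :
    Integrable (fun y : EuclideanSpace ℝ (Fin N) =>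
      min 1 (‖y‖ ^ 2) / ‖y‖ ^ ((N : ℝ) + 2 * s)) := by
  have : Nontrivial (EuclideanSpace ℝ (Fin N)) := by
    apply Module.nontrivial_of_finrank_pos (R := ℝ)
    simp; omega
  rw [integrable_fun_norm_addHaar volume (f := fun r : ℝ => min 1 (r ^ 2) / r ^ ((N : ℝ) + 2 * s))]
  rw [← Ioo_union_Ici_eq_Ioi (zero_lt_one (α := ℝ))]
  have hpow : ∀ y : ℝ, 0 < y → y ^ (N - 1) = y ^ ((N : ℝ) - 1) := by
    intro y hy
    rw [← Real.rpow_natCast, Nat.cast_sub hN, Nat.cast_one]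
  refine IntegrableOn.union ?_ ?_
  · have h := (intervalIntegral.integrableOn_Ioo_rpow_iff (s := 1 - 2 * s) zero_lt_one).2
      (by linarith)
    refine h.congr_fun (fun y hy => ?_) measurableSet_Ioo
    have h1 : y ^ 2 ≤ 1 := by nlinarith [hy.1, hy.2]
    simp only [finrank_euclideanSpace, Fintype.card_fin, smul_eq_mul, min_eq_right h1]
    rw [hpow y hy.1, ← Real.rpow_natCast y 2, ← Real.rpow_sub hy.1, ← Real.rpow_add hy.1]
    congr 1; push_cast; ring
  · rw [integrableOn_Ici_iff_integrableOn_Ioi]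
    have h := integrableOn_Ioi_rpow_of_lt (a := - 1 - 2 * s) (by linarith) zero_lt_one
    refine h.congr_fun (fun y hy => ?_) measurableSet_Ioi
    have hy' : (1 : ℝ) < y := hy
    have hy0 : 0 < y := by linarith
    have h1 : 1 ≤ y ^ 2 := by nlinarith
    simp only [finrank_euclideanSpace, Fintype.card_fin, smul_eq_mul, min_eq_left h1]
    rw [hpow y hy0, one_div, ← Real.rpow_neg hy0.le, ← Real.rpow_add hy0]
    congr 1; ring

theorem measurable_second_difference_div {N : ℕ} {f : EuclideanSpace ℝ (Fin N) → ℝ}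
    (hf : Continuous f) (r : ℝ) :
    Measurable (fun z : EuclideanSpace ℝ (Fin N) × EuclideanSpace ℝ (Fin N) =>
      (2 * f z.1 - f (z.1 + z.2) - f (z.1 - z.2)) / ‖z.2‖ ^ r) := by
  have := hf.measurable
  fun_prop

theorem integrable_second_difference_div {N : ℕ} (hN : 1 ≤ N) {s : ℝ} (hs0 : 0 < s) (hs1 : s < 1)
    {f : EuclideanSpace ℝ (Fin N) → ℝ} (hf : ContDiff ℝ ∞ f) (hc : HasCompactSupport f)
    (x : EuclideanSpace ℝ (Fin N)) :
    Integrable (fun y => (2 * f x - f (x + y) - f (x - y)) / ‖y‖ ^ ((N : ℝ) + 2 * s)) := by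
  obtain ⟨C, -, hC⟩ := exists_second_difference_bound hf hc
  refine ((integrable_min_one_sq_div_norm_rpow hN hs0 hs1).const_mul C).mono'
    ((measurable_second_difference_div hf.continuous _).comp
      measurable_prodMk_left).aestronglyMeasurable (.of_forall fun y => ?_)
  rw [norm_div, Real.norm_eq_abs, Real.norm_eq_abs,
    abs_of_nonneg (by positivity : 0 ≤ ‖y‖ ^ ((N : ℝ) + 2 * s)), ← mul_div_assoc]
  gcongr
  exact hC x y

theorem fracLaplacian_add {N : ℕ} (hN : 1 ≤ N) {s : ℝ} (hs0 : 0 ≤ s) (hs1 : s ≤ 1)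
    {f g : EuclideanSpace ℝ (Fin N) → ℝ} (hf : ContDiff ℝ ∞ f) (hfc : HasCompactSupport f)
    (hg : ContDiff ℝ ∞ g) (hgc : HasCompactSupport g) (x : EuclideanSpace ℝ (Fin N)) :
    fracLaplacian s (fun x => f x + g x) x = fracLaplacian s f x + fracLaplacian s g x := by
  unfold fracLaplacian
  split_ifs with h0 h1
  · rfl
  · have := (hf.contDiffAt (x := x)).of_le (m := 2) (by norm_cast)
    have h := this.laplacian_add ((hg.contDiffAt (x := x)).of_le (m := 2) (by norm_cast))
    change -(Laplacian.laplacian (f + g) x) = _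
    rw [h]; ring
  · have hs0' := lt_of_le_of_ne hs0 (Ne.symm h0)
    have hs1' := lt_of_le_of_ne hs1 h1
    rw [← mul_add, ← integral_add (integrable_second_difference_div hN hs0' hs1' hf hfc x)
      (integrable_second_difference_div hN hs0' hs1' hg hgc x)]
    congr 2
    ext y
    ring

theorem fracLaplacian_const_mul {N : ℕ} (s c : ℝ)
    {f : EuclideanSpace ℝ (Fin N) → ℝ} (hf : ContDiff ℝ ∞ f) (x : EuclideanSpace ℝ (Fin N)) :
    fracLaplacian s (fun x => c * f x) x = c * fracLaplacian s f x := by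
  unfold fracLaplacian
  split_ifs with h0 h1
  · rfl
  · have h := InnerProductSpace.laplacian_smul (𝕜 := ℝ) c
      ((hf.contDiffAt (x := x)).of_le (m := 2) (by norm_cast))
    change -(Laplacian.laplacian (c • f) x) = _
    rw [h, smul_eq_mul]; ring
  · rw [mul_left_comm c, ← integral_const_mul c]
    congr 1
    refine integral_congr_ae (.of_forall fun y => ?_)
    simp only
    ring

theorem fracLaplacian_zero_fun {N : ℕ} (s : ℝ) (x : EuclideanSpace ℝ (Fin N)) :
    fracLaplacian s (fun _ => (0 : ℝ)) x = 0 := by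
  simpa using fracLaplacian_const_mul s 0 (f := fun _ => (0 : ℝ)) contDiff_const x

/-- Homogeneity of degree 2s. In the nonlocal case y ↦ ay turns the kernel into a^{N+2s} and the
volume element into a^{-N}. -/
theorem fracLaplacian_comp_smul {N : ℕ} {s a : ℝ} (ha : 0 < a)
    {f : EuclideanSpace ℝ (Fin N) → ℝ} (hf : ContDiff ℝ ∞ f) (x : EuclideanSpace ℝ (Fin N)) :
    fracLaplacian s (fun x => f (a • x)) x = a ^ (2 * s) * fracLaplacian s f (a • x) := by
  unfold fracLaplacian
  split_ifs with h0 h1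
  · simp [h0]
  · rw [InnerProductSpace.laplacian_eq_iteratedFDeriv_stdOrthonormalBasis,
      InnerProductSpace.laplacian_eq_iteratedFDeriv_stdOrthonormalBasis,
      iteratedFDeriv_comp_const_smul a (hf.of_le (by norm_cast))]
    simp only [smul_apply, smul_eq_mul, ← Finset.mul_sum, h1]
    norm_num
  · rw [mul_left_comm]
    congr 1
    have h := Measure.integral_comp_smul_of_nonneg (hR := ha.le) volume
      (fun y : EuclideanSpace ℝ (Fin N) =>
      (2 * f (a • x) - f (a • x + y) - f (a • x - y)) / ‖y‖ ^ ((N : ℝ) + 2 * s)) a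
    have e : ∀ y : EuclideanSpace ℝ (Fin N),
        (2 * f (a • x) - f (a • (x + y)) - f (a • (x - y))) / ‖y‖ ^ ((N : ℝ) + 2 * s) =
        a ^ ((N : ℝ) + 2 * s) * ((2 * f (a • x) - f (a • x + a • y) - f (a • x - a • y)) /
          ‖a • y‖ ^ ((N : ℝ) + 2 * s)) := by
      intro y
      rw [norm_smul, Real.norm_eq_abs, abs_of_pos ha, Real.mul_rpow ha.le (norm_nonneg _),
        smul_add, smul_sub]
      have : a ^ ((N : ℝ) + 2 * s) ≠ 0 := (Real.rpow_pos_of_pos ha _).ne'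
      field_simp
    simp_rw [e]
    rw [integral_const_mul, h, finrank_euclideanSpace, Fintype.card_fin, smul_eq_mul, ← mul_assoc,
      Real.rpow_add ha, Real.rpow_natCast]
    field_simp

theorem measurable_fracLaplacian {N : ℕ} (s : ℝ) {f : EuclideanSpace ℝ (Fin N) → ℝ}
    (hf : ContDiff ℝ ∞ f) : Measurable (fracLaplacian s f) := by
  by_cases h0 : s = 0
  · have : fracLaplacian s f = f := by ext x; simp [fracLaplacian, h0]
    rw [this]; exact hf.continuous.measurable
  by_cases h1 : s = 1
  · have : fracLaplacian s f = fun x => -(Laplacian.laplacian f x) := by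
      ext x; simp [fracLaplacian, h1]
    rw [this, InnerProductSpace.laplacian_eq_iteratedFDeriv_stdOrthonormalBasis]
    have hc : Continuous (iteratedFDeriv ℝ 2 f) := hf.continuous_iteratedFDeriv (by norm_cast)
    refine Measurable.neg (Continuous.measurable ?_)
    refine continuous_finsetSum _ fun i _ => ?_
    exact (ContinuousMultilinearMap.apply ℝ (fun _ : Fin 2 => EuclideanSpace ℝ (Fin N)) ℝ
      _).continuous.comp hc
  · have h : Measurable fun x => ∫ y, (2 * f x - f (x + y) - f (x - y)) / ‖y‖ ^ ((N : ℝ) + 2 * s) :=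
      ((measurable_second_difference_div hf.continuous _).stronglyMeasurable.integral_prod_right'
        (ν := volume)).measurable
    have : fracLaplacian s f = fun x => s * 2 ^ (2 * s - 1) * Real.Gamma (((N : ℝ) + 2 * s) / 2) /
        (Real.pi ^ ((N : ℝ) / 2) * Real.Gamma (1 - s)) *
        ∫ y, (2 * f x - f (x + y) - f (x - y)) / ‖y‖ ^ ((N : ℝ) + 2 * s) := by
      ext x; simp [fracLaplacian, h0, h1]
    rw [this]
    exact h.const_mul _

theorem HasCompactSupport.exists_bound_one_add_norm_rpow {N : ℕ}
    {g : EuclideanSpace ℝ (Fin N) → ℝ} (hg : Continuous g) (hc : HasCompactSupport g) (M : ℝ) :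
    ∃ C : ℝ, 0 ≤ C ∧ ∀ x, |g x| ≤ C * (1 + ‖x‖) ^ (-M) := by
  have hpos : ∀ x : EuclideanSpace ℝ (Fin N), 0 < 1 + ‖x‖ := fun x => by positivity
  have hcont : Continuous fun x => g x * (1 + ‖x‖) ^ M :=
    hg.mul ((continuous_const.add continuous_norm).rpow_const fun x => .inl (hpos x).ne')
  obtain ⟨C, hC⟩ := (hc.mul_right (f' := fun x => (1 + ‖x‖) ^ M)).exists_bound_of_continuous hcont
  refine ⟨C, (norm_nonneg _).trans (hC 0), fun x => ?_⟩
  have h : ‖g x * (1 + ‖x‖) ^ M‖ ≤ C := hC x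
  have h1 : 0 < (1 + ‖x‖) ^ M := Real.rpow_pos_of_pos (hpos x) M
  rw [norm_mul, Real.norm_eq_abs, Real.norm_eq_abs, abs_of_pos h1] at h
  rwa [Real.rpow_neg (hpos x).le, ← div_eq_mul_inv, le_div_iff₀ h1]

/-- The Laplacian is local and preserves compact support, so the decay rate M is arbitrary; this is
why s = 1 puts no upper limit on q. -/
theorem exists_fracLaplacian_one_bound {N : ℕ} {f : EuclideanSpace ℝ (Fin N) → ℝ}
    (hf : ContDiff ℝ ∞ f) (hc : HasCompactSupport f) (M : ℝ) :
    ∃ C : ℝ, 0 ≤ C ∧ ∀ x, |fracLaplacian 1 f x| ≤ C * (1 + ‖x‖) ^ (-M) := by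
  have hcont : Continuous (iteratedFDeriv ℝ 2 f) := hf.continuous_iteratedFDeriv (by norm_cast)
  let G : (EuclideanSpace ℝ (Fin N) [×2]→L[ℝ] ℝ) → ℝ := fun L =>
    -∑ i, L ![(stdOrthonormalBasis ℝ (EuclideanSpace ℝ (Fin N))) i,
      (stdOrthonormalBasis ℝ (EuclideanSpace ℝ (Fin N))) i]
  have hG : Continuous G := by
    refine Continuous.neg (continuous_finsetSum _ fun i _ => ?_)
    exact (ContinuousMultilinearMap.apply ℝ (fun _ : Fin 2 => EuclideanSpace ℝ (Fin N)) ℝ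
      _).continuous
  have e : fracLaplacian 1 f = G ∘ iteratedFDeriv ℝ 2 f := by
    ext x
    simp [fracLaplacian, InnerProductSpace.laplacian_eq_iteratedFDeriv_stdOrthonormalBasis, G]
  rw [e]
  exact HasCompactSupport.exists_bound_one_add_norm_rpow (hG.comp hcont)
    ((hc.iteratedFDeriv 2).comp_left (by simp [G])) M

/-- Far from the support f(x) = 0, and only y with x+y or x-y in the support contribute. These have
|y| ≥ (1+|x|)/4, so the kernel is at most 4^M(1+|x|)^{-M}, and what remains is twice the L¹ norm of
f. -/
theorem abs_integral_second_difference_div_le_of_lt {N : ℕ} {M R : ℝ} (hM0 : 0 ≤ M) (hR1 : 1 ≤ R)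
    {f : EuclideanSpace ℝ (Fin N) → ℝ} (hR : ∀ x, R < ‖x‖ → f x = 0) (hfi : Integrable f)
    {x : EuclideanSpace ℝ (Fin N)} (hx : 2 * R < ‖x‖) :
    |∫ y, (2 * f x - f (x + y) - f (x - y)) / ‖y‖ ^ M| ≤
      2 * (∫ y, |f y|) * 4 ^ M * (1 + ‖x‖) ^ (-M) := by
  have hx1 : 0 < 1 + ‖x‖ := by positivity
  have hA : Integrable fun y => |f (x + y)| := (hfi.comp_add_left x).abs
  have hB : Integrable fun y => |f (x - y)| := (hfi.comp_sub_left x).abs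
  have h1 : |∫ y, (2 * f x - f (x + y) - f (x - y)) / ‖y‖ ^ M| ≤
      ∫ y, (|f (x + y)| + |f (x - y)|) * (4 ^ M * (1 + ‖x‖) ^ (-M)) := by
    rw [← Real.norm_eq_abs]
    refine norm_integral_le_of_norm_le ((hA.add hB).mul_const _) (.of_forall fun y => ?_)
    rw [hR x (by linarith)]
    by_cases hz : f (x + y) = 0 ∧ f (x - y) = 0
    · simp [hz.1, hz.2]
    have hy : (1 + ‖x‖) / 4 ≤ ‖y‖ := by
      by_contra hy
      apply hz
      constructor
      · apply hR
        have := norm_sub_norm_le x (-y)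
        rw [norm_neg, sub_neg_eq_add] at this
        linarith
      · apply hR
        have := norm_sub_norm_le x y
        linarith
    rw [norm_div, Real.norm_eq_abs, Real.norm_eq_abs,
      abs_of_nonneg (by positivity : 0 ≤ ‖y‖ ^ M), div_eq_mul_inv]
    have h4 : (‖y‖ ^ M)⁻¹ ≤ 4 ^ M * (1 + ‖x‖) ^ (-M) := by
      have : 4 ^ M * (1 + ‖x‖) ^ (-M) = (((1 + ‖x‖) / 4) ^ M)⁻¹ := by
        rw [Real.div_rpow hx1.le (by norm_num), Real.rpow_neg hx1.le, inv_div, div_eq_mul_inv]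
      rw [this]
      exact inv_anti₀ (by positivity) (Real.rpow_le_rpow (by positivity) hy hM0)
    refine mul_le_mul ?_ h4 (by positivity) (by positivity)
    have := abs_add_le (-f (x + y)) (-f (x - y))
    rw [abs_neg, abs_neg] at this
    refine le_trans (le_of_eq ?_) this
    congr 1; ring
  have e1 : ∫ y, |f (x + y)| = ∫ y, |f y| := integral_add_left_eq_self (fun y => |f y|) x
  have e2 : ∫ y, |f (x - y)| = ∫ y, |f y| := integral_sub_left_eq_self (fun y => |f y|) volume x
  rw [integral_mul_const, integral_add hA hB, e1, e2] at h1
  refine h1.trans (le_of_eq ?_)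
  ring

/-- The decay is that of the kernel. Near the support the integral is merely bounded, which suffices
because 1+|x| is bounded there. -/
theorem exists_fracLaplacian_bound {N : ℕ} (hN : 1 ≤ N) {s : ℝ} (hs0 : 0 < s) (hs1 : s < 1)
    {f : EuclideanSpace ℝ (Fin N) → ℝ} (hf : ContDiff ℝ ∞ f) (hc : HasCompactSupport f) :
    ∃ C : ℝ, 0 ≤ C ∧ ∀ x, |fracLaplacian s f x| ≤ C * (1 + ‖x‖) ^ (-((N : ℝ) + 2 * s)) := by
  set M : ℝ := (N : ℝ) + 2 * s with hM
  have hM0 : 0 < M := by positivity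
  suffices h : ∃ C : ℝ, 0 ≤ C ∧ ∀ x, |∫ y, (2 * f x - f (x + y) - f (x - y)) / ‖y‖ ^ M|
      ≤ C * (1 + ‖x‖) ^ (-M) by
    obtain ⟨C, hC0, hC⟩ := h
    refine ⟨|s * 2 ^ (2 * s - 1) * Real.Gamma (((N : ℝ) + 2 * s) / 2) /
        (Real.pi ^ ((N : ℝ) / 2) * Real.Gamma (1 - s))| * C, by positivity, fun x => ?_⟩
    rw [fracLaplacian, if_neg hs0.ne', if_neg hs1.ne, abs_mul, mul_assoc |_|]
    exact mul_le_mul_of_nonneg_left (hC x) (abs_nonneg _)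
  obtain ⟨R, hR1, hR⟩ : ∃ R : ℝ, 1 ≤ R ∧ ∀ x, R < ‖x‖ → f x = 0 := by
    obtain ⟨R, hR⟩ := hc.isCompact.isBounded.exists_norm_le
    refine ⟨max 1 R, le_max_left _ _, fun x hx => ?_⟩
    by_contra h
    exact absurd (hR x (subset_tsupport f h)) (not_le.2 ((le_max_right _ _).trans_lt hx))
  obtain ⟨C₀, hC₀, hb⟩ := exists_second_difference_bound hf hc
  obtain ⟨I, hI⟩ : ∃ I : ℝ, I = ∫ y : EuclideanSpace ℝ (Fin N), min 1 (‖y‖ ^ 2) / ‖y‖ ^ M :=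
    ⟨_, rfl⟩
  have hI0 : 0 ≤ I := hI ▸ integral_nonneg fun y => by positivity
  have hfi : Integrable f := hf.continuous.integrable_of_hasCompactSupport hc
  obtain ⟨J, hJ⟩ : ∃ J : ℝ, J = ∫ y, |f y| := ⟨_, rfl⟩
  have hJ0 : 0 ≤ J := hJ ▸ integral_nonneg fun y => abs_nonneg _
  refine ⟨C₀ * I * (3 * R) ^ M + 2 * J * 4 ^ M, by positivity, fun x => ?_⟩
  have hx1 : 0 < 1 + ‖x‖ := by positivity
  rw [add_mul]
  rcases le_or_gt ‖x‖ (2 * R) with hx | hx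
  · have h1 : |∫ y, (2 * f x - f (x + y) - f (x - y)) / ‖y‖ ^ M| ≤ C₀ * I := by
      rw [hI, ← integral_const_mul, ← Real.norm_eq_abs]
      refine norm_integral_le_of_norm_le
        ((integrable_min_one_sq_div_norm_rpow hN hs0 hs1).const_mul C₀) (.of_forall fun y => ?_)
      rw [norm_div, Real.norm_eq_abs, Real.norm_eq_abs,
        abs_of_nonneg (by positivity : 0 ≤ ‖y‖ ^ M), ← mul_div_assoc]
      gcongr
      exact hb x y
    -- Here 1+|x| ≤ 1+2R ≤ 3R, as R ≥ 1.
    have h2 : 1 ≤ (3 * R) ^ M * (1 + ‖x‖) ^ (-M) := by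
      rw [Real.rpow_neg hx1.le, ← div_eq_mul_inv, one_le_div (by positivity)]
      exact Real.rpow_le_rpow hx1.le (by linarith) hM0.le
    have h3 : C₀ * I ≤ C₀ * I * (3 * R) ^ M * (1 + ‖x‖) ^ (-M) := by
      rw [mul_assoc (C₀ * I)]
      exact le_mul_of_one_le_right (by positivity) h2
    have : 0 ≤ 2 * J * 4 ^ M * (1 + ‖x‖) ^ (-M) := by positivity
    linarith
  · have h1 := abs_integral_second_difference_div_le_of_lt hM0.le hR1 hR hfi hx
    rw [← hJ] at h1
    have : 0 ≤ C₀ * I * (3 * R) ^ M * (1 + ‖x‖) ^ (-M) := by positivity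
    exact h1.trans (le_add_of_nonneg_left this)

/-! ### Test functions comparable to the decay weight -/

/-- The finite superposition `∑_{k < n} 2^{-kq} θ(2^{-k} x)` of dyadic dilates of `θ`. -/
noncomputable def dyadicSuperposition {N : ℕ} (θ : EuclideanSpace ℝ (Fin N) → ℝ) (q : ℝ) (n : ℕ)
    (x : EuclideanSpace ℝ (Fin N)) : ℝ :=
  ∑ k ∈ Finset.range n, ((1 / 2 : ℝ) ^ k) ^ q * θ ((1 / 2 : ℝ) ^ k • x)

section Dyadic

variable {N : ℕ} {θ : EuclideanSpace ℝ (Fin N) → ℝ} {q : ℝ}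

theorem dyadicSuperposition_zero (x : EuclideanSpace ℝ (Fin N)) :
    dyadicSuperposition θ q 0 x = 0 := by
  simp [dyadicSuperposition]

theorem dyadicSuperposition_succ (n : ℕ) (x : EuclideanSpace ℝ (Fin N)) :
    dyadicSuperposition θ q (n + 1) x =
      dyadicSuperposition θ q n x + ((1 / 2 : ℝ) ^ n) ^ q * θ ((1 / 2 : ℝ) ^ n • x) := by
  simp only [dyadicSuperposition, Finset.sum_range_succ]

/-- Splitting off the first term instead of the last exposes the self-similarity on which the
two-sided comparison with the weight rests. -/
theorem dyadicSuperposition_succ' (n : ℕ) (x : EuclideanSpace ℝ (Fin N)) :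
    dyadicSuperposition θ q (n + 1) x =
      (1 / 2 : ℝ) ^ q * dyadicSuperposition θ q n ((1 / 2 : ℝ) • x) + θ x := by
  simp only [dyadicSuperposition, Finset.sum_range_succ', Finset.mul_sum]
  congr 1
  · refine Finset.sum_congr rfl fun k _ => ?_
    rw [pow_succ, Real.mul_rpow (by positivity) (by positivity), smul_smul]
    ring
  · simp

theorem contDiff_dyadicSuperposition (hθ : ContDiff ℝ ∞ θ) (n : ℕ) :
    ContDiff ℝ ∞ (dyadicSuperposition θ q n) := by
  unfold dyadicSuperposition
  exact ContDiff.sum fun k _ => contDiff_const.mul (hθ.comp (contDiff_const_smul _))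

theorem hasCompactSupport_dyadic_term (hc : HasCompactSupport θ) (k : ℕ) (c : ℝ) :
    HasCompactSupport fun x => c * θ ((1 / 2 : ℝ) ^ k • x) :=
  (hc.comp_smul (c := (1 / 2 : ℝ) ^ k) (by positivity)).mul_left

theorem hasCompactSupport_dyadicSuperposition (hc : HasCompactSupport θ) (n : ℕ) :
    HasCompactSupport (dyadicSuperposition θ q n) := by
  induction n with
  | zero =>
    have : dyadicSuperposition θ q 0 = 0 := funext dyadicSuperposition_zero
    rw [this]; exact HasCompactSupport.zero
  | succ n ih =>
    have : dyadicSuperposition θ q (n + 1) = dyadicSuperposition θ q n +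
        fun x => ((1 / 2 : ℝ) ^ n) ^ q * θ ((1 / 2 : ℝ) ^ n • x) :=
      funext (dyadicSuperposition_succ n)
    rw [this]
    exact ih.add (hasCompactSupport_dyadic_term hc n _)

theorem fracLaplacian_dyadicSuperposition (hN : 1 ≤ N) {s : ℝ} (hs0 : 0 ≤ s) (hs1 : s ≤ 1)
    (hθ : ContDiff ℝ ∞ θ) (hc : HasCompactSupport θ) (n : ℕ) (x : EuclideanSpace ℝ (Fin N)) :
    fracLaplacian s (dyadicSuperposition θ q n) x = ∑ k ∈ Finset.range n,
      ((1 / 2 : ℝ) ^ k) ^ q * (((1 / 2 : ℝ) ^ k) ^ (2 * s) *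
        fracLaplacian s θ ((1 / 2 : ℝ) ^ k • x)) := by
  induction n with
  | zero =>
    have : dyadicSuperposition θ q 0 = fun _ => 0 := funext dyadicSuperposition_zero
    rw [this, fracLaplacian_zero_fun]; simp
  | succ n ih =>
    have : dyadicSuperposition θ q (n + 1) = fun x => dyadicSuperposition θ q n x +
        ((1 / 2 : ℝ) ^ n) ^ q * θ ((1 / 2 : ℝ) ^ n • x) :=
      funext (dyadicSuperposition_succ n)
    have hθn : ContDiff ℝ ∞ fun x => θ ((1 / 2 : ℝ) ^ n • x) := hθ.comp (contDiff_const_smul _)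
    rw [this, fracLaplacian_add hN hs0 hs1 (contDiff_dyadicSuperposition hθ n)
      (hasCompactSupport_dyadicSuperposition hc n) (contDiff_const.mul hθn)
      (hasCompactSupport_dyadic_term hc n _), ih, Finset.sum_range_succ,
      fracLaplacian_const_mul s _ hθn, fracLaplacian_comp_smul (by positivity) hθ]

/-- With a = 2^{-k} ≤ 1 one has 1+a|x| ≥ a(1+|x|), so the k-th term is at most C
a^{q+2s-M}(1+|x|)^{-M}: a geometric series, convergent since M < q+2s, whose sum bounds all n at
once. -/
theorem abs_fracLaplacian_dyadicSuperposition_le (hN : 1 ≤ N) {s : ℝ} (hs0 : 0 ≤ s) (hs1 : s ≤ 1)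
    (hθ : ContDiff ℝ ∞ θ) (hc : HasCompactSupport θ) {M C : ℝ} (hM0 : 0 ≤ M)
    (hM : M < q + 2 * s) (hC0 : 0 ≤ C)
    (hC : ∀ x, |fracLaplacian s θ x| ≤ C * (1 + ‖x‖) ^ (-M)) (n : ℕ)
    (x : EuclideanSpace ℝ (Fin N)) :
    |fracLaplacian s (dyadicSuperposition θ q n) x| ≤
      C * (1 - (1 / 2 : ℝ) ^ (q + 2 * s - M))⁻¹ * (1 + ‖x‖) ^ (-M) := by
  rw [fracLaplacian_dyadicSuperposition hN hs0 hs1 hθ hc]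
  set b : ℝ := (1 / 2 : ℝ) ^ (q + 2 * s - M) with hb
  have hb0 : 0 ≤ b := by positivity
  have hb1 : b < 1 := Real.rpow_lt_one (by norm_num) (by norm_num) (by linarith)
  have hterm : ∀ k ∈ Finset.range n, |((1 / 2 : ℝ) ^ k) ^ q * (((1 / 2 : ℝ) ^ k) ^ (2 * s) *
        fracLaplacian s θ ((1 / 2 : ℝ) ^ k • x))| ≤ C * (1 + ‖x‖) ^ (-M) * b ^ k := by
    intro k _
    set a : ℝ := (1 / 2 : ℝ) ^ k with ha
    have ha0 : 0 < a := by positivity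
    have ha1 : a ≤ 1 := pow_le_one₀ (by norm_num) (by norm_num)
    have hbk : b ^ k = a ^ q * a ^ (2 * s) * a ^ (-M) := by
      rw [← Real.rpow_add ha0, ← Real.rpow_add ha0, hb, ha, ← Real.rpow_natCast,
        ← Real.rpow_natCast (1 / 2) k, ← Real.rpow_mul (by norm_num), ← Real.rpow_mul (by norm_num)]
      congr 1; ring
    have h1 : (1 + ‖a • x‖) ^ (-M) ≤ a ^ (-M) * (1 + ‖x‖) ^ (-M) := by
      rw [← Real.mul_rpow ha0.le (by positivity)]
      refine Real.rpow_le_rpow_of_nonpos (by positivity) ?_ (by linarith)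
      rw [norm_smul, Real.norm_eq_abs, abs_of_pos ha0]
      linarith
    rw [abs_mul, abs_mul, abs_of_nonneg (by positivity), abs_of_nonneg (by positivity), hbk]
    calc a ^ q * (a ^ (2 * s) * |fracLaplacian s θ (a • x)|)
        ≤ a ^ q * (a ^ (2 * s) * (C * (a ^ (-M) * (1 + ‖x‖) ^ (-M)))) := by
          gcongr
          exact (hC _).trans (by gcongr)
      _ = _ := by ring
  refine (Finset.abs_sum_le_sum_abs _ _).trans ((Finset.sum_le_sum hterm).trans ?_)
  rw [← Finset.mul_sum, mul_right_comm]
  gcongr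
  rw [← tsum_geometric_of_lt_one hb0 hb1]
  exact (summable_geometric_of_lt_one hb0 hb1).sum_le_tsum _ fun _ _ => by positivity

theorem dyadicSuperposition_nonneg (h0 : ∀ x, 0 ≤ θ x) (n : ℕ) (x : EuclideanSpace ℝ (Fin N)) :
    0 ≤ dyadicSuperposition θ q n x :=
  Finset.sum_nonneg fun _ _ => mul_nonneg (by positivity) (h0 _)

/-- This serves s = 0, where M = q violates M < q+2s and the geometric series is not available; the
support of θ is used instead. By self-similarity the inductive bound becomes K(2+|x|)^{-q}. For |x|
≥ 2 nothing is added; for |x| < 2 one gains the factor (3/4)^q, and K is chosen so that the slack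
absorbs θ ≤ 1. -/
theorem dyadicSuperposition_le (hq : 0 < q) (h1 : ∀ x, θ x ≤ 1)
    (h2 : ∀ x, 2 ≤ ‖x‖ → θ x = 0) (n : ℕ) (x : EuclideanSpace ℝ (Fin N)) :
    dyadicSuperposition θ q n x ≤
      (3 ^ (-q) * (1 - (3 / 4 : ℝ) ^ q))⁻¹ * (1 + ‖x‖) ^ (-q) := by
  have hδ : 0 < 1 - (3 / 4 : ℝ) ^ q :=
    sub_pos.2 (Real.rpow_lt_one (by norm_num) (by norm_num) hq)
  set K : ℝ := (3 ^ (-q) * (1 - (3 / 4 : ℝ) ^ q))⁻¹ with hK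
  have hK0 : 0 < K := by positivity
  induction n generalizing x with
  | zero => rw [dyadicSuperposition_zero]; positivity
  | succ n ih =>
    rw [dyadicSuperposition_succ']
    have hx := ih ((1 / 2 : ℝ) • x)
    have e : (1 / 2 : ℝ) ^ q * (1 + ‖(1 / 2 : ℝ) • x‖) ^ (-q) = (2 + ‖x‖) ^ (-q) := by
      rw [one_div, Real.inv_rpow (by norm_num), ← Real.rpow_neg (by norm_num),
        ← Real.mul_rpow (by norm_num) (by positivity), norm_smul]
      congr 1
      norm_num
      ring
    have h3 : (1 / 2 : ℝ) ^ q * dyadicSuperposition θ q n ((1 / 2 : ℝ) • x) ≤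
        K * (2 + ‖x‖) ^ (-q) := by
      rw [← e]
      calc _ ≤ (1 / 2 : ℝ) ^ q * (K * (1 + ‖(1 / 2 : ℝ) • x‖) ^ (-q)) := by gcongr
        _ = _ := by ring
    rcases le_or_gt 2 ‖x‖ with h | h
    · rw [h2 x h, add_zero]
      refine h3.trans ?_
      gcongr ?_ * ?_
      exact Real.rpow_le_rpow_of_nonpos (by positivity) (by linarith) (by linarith)
    · have h4 : (2 + ‖x‖) ^ (-q) ≤ (3 / 4 : ℝ) ^ q * (1 + ‖x‖) ^ (-q) := by
        have : (3 / 4 : ℝ) ^ q = (4 / 3 : ℝ) ^ (-q) := by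
          rw [Real.rpow_neg (by norm_num), ← Real.inv_rpow (by norm_num)]; norm_num
        rw [this, ← Real.mul_rpow (by norm_num) (by positivity)]
        refine Real.rpow_le_rpow_of_nonpos (by positivity) ?_ (by linarith)
        linarith
      have h5 : (3 : ℝ) ^ (-q) ≤ (1 + ‖x‖) ^ (-q) :=
        Real.rpow_le_rpow_of_nonpos (by positivity) (by linarith) (by linarith)
      have h6 : 1 ≤ K * ((1 - (3 / 4 : ℝ) ^ q) * (1 + ‖x‖) ^ (-q)) := by
        rw [hK, inv_mul_eq_div, one_le_div (by positivity), mul_comm]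
        gcongr
      have h7 := mul_le_mul_of_nonneg_left h4 hK0.le
      have h8 := h1 x
      linarith

/-- One term suffices: halving x repeatedly brings it into 1/2 ≤ |x| ≤ 1, where θ = 1, and
(2|x|)^{-q} scales exactly like the recursion. The terms k = 0, …, n reach |x| ≤ 2^n, hence the
index n+1. -/
theorem le_dyadicSuperposition (hq : 0 < q) (h0 : ∀ x, 0 ≤ θ x) (h1 : ∀ x, ‖x‖ ≤ 1 → θ x = 1)
    (n : ℕ) (x : EuclideanSpace ℝ (Fin N)) (hx : 1 / 2 ≤ ‖x‖) (hxn : ‖x‖ ≤ 2 ^ n) :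
    (2 * ‖x‖) ^ (-q) ≤ dyadicSuperposition θ q (n + 1) x := by
  induction n generalizing x with
  | zero =>
    rw [dyadicSuperposition_succ', dyadicSuperposition_zero, h1 x (by simpa using hxn)]
    have : (2 * ‖x‖) ^ (-q) ≤ 1 :=
      Real.rpow_le_one_of_one_le_of_nonpos (by linarith) (by linarith)
    linarith
  | succ n ih =>
    rw [dyadicSuperposition_succ']
    rcases le_or_gt ‖x‖ 1 with h | h
    · rw [h1 x h]
      have := dyadicSuperposition_nonneg (q := q) h0 (n + 1) ((1 / 2 : ℝ) • x)
      have h2 : (2 * ‖x‖) ^ (-q) ≤ 1 :=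
        Real.rpow_le_one_of_one_le_of_nonpos (by linarith) (by linarith)
      have h3 : 0 ≤ (1 / 2 : ℝ) ^ q * dyadicSuperposition θ q (n + 1) ((1 / 2 : ℝ) • x) := by
        positivity
      linarith
    · have e : ‖(1 / 2 : ℝ) • x‖ = ‖x‖ / 2 := by rw [norm_smul]; norm_num; ring
      have := ih ((1 / 2 : ℝ) • x) (by rw [e]; linarith) (by rw [e]; rw [pow_succ] at hxn; linarith)
      have h2 : (2 * ‖x‖) ^ (-q) = (1 / 2 : ℝ) ^ q * (2 * ‖(1 / 2 : ℝ) • x‖) ^ (-q) := by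
        rw [one_div, Real.inv_rpow (by norm_num), ← Real.rpow_neg (by norm_num),
          ← Real.mul_rpow (by norm_num) (by positivity), ← one_div, e]
        congr 1; ring
      rw [h2]
      have h3 := mul_le_mul_of_nonneg_left this (by positivity : 0 ≤ (1 / 2 : ℝ) ^ q)
      have := h0 x
      linarith

theorem le_dyadicSuperposition' (hq : 0 < q) (h0 : ∀ x, 0 ≤ θ x) (h1 : ∀ x, ‖x‖ ≤ 1 → θ x = 1)
    (n : ℕ) (x : EuclideanSpace ℝ (Fin N)) (hxn : ‖x‖ ≤ 2 ^ n) :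
    2 ^ (-q) * (1 + ‖x‖ ^ 2) ^ (-q / 2) ≤ dyadicSuperposition θ q (n + 1) x := by
  rcases le_or_gt (1 / 2) ‖x‖ with h | h
  · refine le_trans ?_ (le_dyadicSuperposition hq h0 h1 n x h hxn)
    rw [Real.mul_rpow (by norm_num) (by positivity)]
    gcongr
    have : ‖x‖ ^ (-q) = (‖x‖ ^ 2) ^ (-q / 2) := by
      rw [← Real.rpow_natCast, ← Real.rpow_mul (by positivity)]; congr 1; push_cast; ring
    rw [this]
    exact Real.rpow_le_rpow_of_nonpos (by positivity) (by linarith) (by linarith)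
  · rw [dyadicSuperposition_succ', h1 x (by linarith)]
    have h2 : (2 : ℝ) ^ (-q) ≤ 1 :=
      Real.rpow_le_one_of_one_le_of_nonpos (by norm_num) (by linarith)
    have h3 : (1 + ‖x‖ ^ 2) ^ (-q / 2) ≤ 1 :=
      Real.rpow_le_one_of_one_le_of_nonpos (by nlinarith [sq_nonneg ‖x‖]) (by linarith)
    have h4 := dyadicSuperposition_nonneg (q := q) h0 n ((1 / 2 : ℝ) • x)
    have h5 : 0 ≤ (1 / 2 : ℝ) ^ q * dyadicSuperposition θ q n ((1 / 2 : ℝ) • x) := by positivity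
    have h6 := mul_le_one₀ h2 (by positivity) h3
    linarith

end Dyadic

theorem one_add_norm_rpow_neg_le {N : ℕ} {q : ℝ} (hq : 0 ≤ q) (x : EuclideanSpace ℝ (Fin N)) :
    (1 + ‖x‖) ^ (-q) ≤ (1 + ‖x‖ ^ 2) ^ (-q / 2) := by
  have : (1 + ‖x‖) ^ (-q) = ((1 + ‖x‖) ^ 2) ^ (-q / 2) := by
    rw [← Real.rpow_natCast, ← Real.rpow_mul (by positivity)]; congr 1; push_cast; ring
  rw [this]
  exact Real.rpow_le_rpow_of_nonpos (by positivity) (by nlinarith [norm_nonneg x]) (by linarith)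

theorem integrable_bracket {N : ℕ} {q : ℝ} (hq : (N : ℝ) < q) :
    Integrable fun x : EuclideanSpace ℝ (Fin N) => (1 + ‖x‖ ^ 2) ^ (-q / 2) :=
  integrable_rpow_neg_one_add_norm_sq (by simpa using hq)

theorem integral_bracket_pos {N : ℕ} {q : ℝ} (hq : (N : ℝ) < q) :
    0 < ∫ x : EuclideanSpace ℝ (Fin N), (1 + ‖x‖ ^ 2) ^ (-q / 2) := by
  refine (integral_pos_iff_support_of_nonneg (fun x => by positivity) (integrable_bracket hq)).2 ?_
  have : Function.support (fun x : EuclideanSpace ℝ (Fin N) => (1 + ‖x‖ ^ 2) ^ (-q / 2)) =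
      univ := by
    ext x
    have : 0 < (1 + ‖x‖ ^ 2) ^ (-q / 2) := by positivity
    simp [this.ne']
  rw [this]
  exact Measure.measure_univ_pos.2 (NeZero.ne _)

theorem decayWeight_pos {N : ℕ} {q : ℝ} (hq : (N : ℝ) < q) (x : EuclideanSpace ℝ (Fin N)) :
    0 < decayWeight N q x := by
  have := integral_bracket_pos hq
  unfold decayWeight
  positivity

theorem integrable_decayWeight {N : ℕ} {q : ℝ} (hq : (N : ℝ) < q) :
    Integrable (decayWeight N q) :=
  (integrable_bracket hq).const_mul _

theorem continuous_decayWeight (N : ℕ) (q : ℝ) : Continuous (decayWeight N q) := by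
  unfold decayWeight
  refine continuous_const.mul ((by fun_prop : Continuous fun x : EuclideanSpace ℝ (Fin N) =>
    1 + ‖x‖ ^ 2).rpow_const fun x => .inl (by positivity))

/-- Smooth compactly supported functions that exhaust the decay weight and whose images under the
admissible operators `(-Δ)^s` are bounded by it. -/
theorem exists_test_functions {N : ℕ} (hN : 1 ≤ N) {q : ℝ} (hq : (N : ℝ) < q) :
    ∃ ψ : ℕ → EuclideanSpace ℝ (Fin N) → ℝ, (∀ n, ContDiff ℝ ∞ (ψ n)) ∧
      (∀ n, HasCompactSupport (ψ n)) ∧ (∀ n x, 0 ≤ ψ n x) ∧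
      (∃ c : ℝ, 0 < c ∧ ∀ n x, ‖x‖ ≤ 2 ^ n → c * decayWeight N q x ≤ ψ n x) ∧
      ∀ s : ℝ, 0 ≤ s → s ≤ 1 → (0 < s → s < 1 → q ≤ N + 2 * s) →
        ∃ C : ℝ, 0 ≤ C ∧ ∀ n x, |fracLaplacian s (ψ n) x| ≤ C * decayWeight N q x := by
  have hq0 : 0 < q := lt_of_le_of_lt (Nat.cast_nonneg N) hq
  let b : ContDiffBump (0 : EuclideanSpace ℝ (Fin N)) := ⟨1, 2, one_pos, one_lt_two⟩
  have hb : ContDiff ℝ ∞ b := b.contDiff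
  have hbc : HasCompactSupport b := b.hasCompactSupport
  have hb1 : ∀ x, ‖x‖ ≤ 1 → b x = 1 := fun x hx => b.one_of_mem_closedBall (by simpa using hx)
  have hb2 : ∀ x, 2 ≤ ‖x‖ → b x = 0 := fun x hx => b.zero_of_le_dist (by simpa using hx)
  set A := ∫ y : EuclideanSpace ℝ (Fin N), (1 + ‖y‖ ^ 2) ^ (-q / 2) with hA
  have hA0 : 0 < A := integral_bracket_pos hq
  have hw : ∀ x : EuclideanSpace ℝ (Fin N), (1 + ‖x‖ ^ 2) ^ (-q / 2) = A * decayWeight N q x := by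
    intro x
    rw [decayWeight, ← hA, mul_inv_cancel_left₀ hA0.ne']
  refine ⟨fun n => dyadicSuperposition b q (n + 1), fun n => contDiff_dyadicSuperposition hb _,
    fun n => hasCompactSupport_dyadicSuperposition hbc _,
    fun n => dyadicSuperposition_nonneg (fun _ => b.nonneg) _,
    ⟨2 ^ (-q) * A, by positivity, fun n x hx => ?_⟩, fun s hs0 hs1 hs => ?_⟩
  · rw [mul_assoc, ← hw]
    exact le_dyadicSuperposition' hq0 (fun _ => b.nonneg) hb1 n x hx
  -- Any decay exponent M ≥ q is enough for domination by χ.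
  suffices h : ∃ C M : ℝ, 0 ≤ C ∧ q ≤ M ∧ ∀ n x,
      |fracLaplacian s (dyadicSuperposition b q (n + 1)) x| ≤ C * (1 + ‖x‖) ^ (-M) by
    obtain ⟨C, M, hC0, hM, hC⟩ := h
    refine ⟨C * A, by positivity, fun n x => (hC n x).trans ?_⟩
    rw [mul_assoc, ← hw]
    gcongr
    refine le_trans ?_ (one_add_norm_rpow_neg_le hq0.le x)
    exact Real.rpow_le_rpow_of_exponent_le (by linarith [norm_nonneg x]) (by linarith)
  rcases hs0.eq_or_lt with rfl | hs0'
  · refine ⟨(3 ^ (-q) * (1 - (3 / 4 : ℝ) ^ q))⁻¹, q, ?_, le_rfl, fun n x => ?_⟩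
    rotate_left
    · simp only [fracLaplacian, if_true]
      rw [abs_of_nonneg (dyadicSuperposition_nonneg (fun _ => b.nonneg) _ _)]
      exact dyadicSuperposition_le hq0 (fun _ => b.le_one) hb2 (n + 1) x
    · have : 0 < 1 - (3 / 4 : ℝ) ^ q :=
        sub_pos.2 (Real.rpow_lt_one (by norm_num) (by norm_num) hq0)
      positivity
  -- M must lie in [q, q+2s). For s = 1 take M = q; for 0 < s < 1 the forced choice M = N+2s works
  -- exactly because N < q ≤ N+2s.
  obtain ⟨M, C, hqM, hMs, hC0, hC⟩ : ∃ M C : ℝ, q ≤ M ∧ M < q + 2 * s ∧ 0 ≤ C ∧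
      ∀ x, |fracLaplacian s b x| ≤ C * (1 + ‖x‖) ^ (-M) := by
    rcases hs1.eq_or_lt with rfl | hs1'
    · obtain ⟨C, hC0, hC⟩ := exists_fracLaplacian_one_bound hb hbc q
      exact ⟨q, C, le_rfl, by linarith, hC0, hC⟩
    · obtain ⟨C, hC0, hC⟩ := exists_fracLaplacian_bound hN hs0' hs1' hb hbc
      exact ⟨_, C, hs hs0' hs1', by linarith, hC0, hC⟩
  have hb' : (1 / 2 : ℝ) ^ (q + 2 * s - M) < 1 :=
    Real.rpow_lt_one (by norm_num) (by norm_num) (by linarith)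
  exact ⟨_, M, mul_nonneg hC0 (inv_nonneg.2 (by linarith)), hqM, fun n x =>
    abs_fracLaplacian_dyadicSuperposition_le hN hs0 hs1 hb hbc (by linarith) hMs hC0 hC (n + 1) x⟩

/-! ### The fractional integral tested against a power of `T - t` -/

theorem intervalIntegrable_pow_div_rpow {α s T : ℝ} (hα : 0 < α) (hsT : s ≤ T) (m : ℕ) :
    IntervalIntegrable (fun t => (T - t) ^ m / (t - s) ^ (1 - α)) volume s T := by
  have h := (intervalIntegral.intervalIntegrable_rpow' (r := α - 1) (a := 0) (b := T - s)
    (by linarith)).comp_sub_right s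
  simp only [zero_add, sub_add_cancel] at h
  have h2 := h.continuousOn_mul (g := fun t => (T - t) ^ m) (by fun_prop)
  refine h2.congr fun t ht => ?_
  rw [uIoc_of_le hsT] at ht
  have : 0 ≤ t - s := by linarith [ht.1]
  rw [div_eq_mul_inv, ← Real.rpow_neg this]
  congr 2; ring

/-- The Beta integral `∫₀¹ (1 - x)^m x^{α - 1} dx`. -/
noncomputable def betaConst (α : ℝ) (m : ℕ) : ℝ :=
  ∫ x in (0 : ℝ)..1, (1 - x) ^ m / (x - 0) ^ (1 - α)

theorem betaConst_pos {α : ℝ} (hα : 0 < α) (m : ℕ) : 0 < betaConst α m := by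
  -- The constant is the case s = 0, T = 1 of the preceding integrand, which explains the x - 0 in
  -- its definition.
  refine intervalIntegral.intervalIntegral_pos_of_pos_on
    (intervalIntegrable_pow_div_rpow hα zero_le_one m) (fun x hx => ?_) one_pos
  have h1 : 0 < 1 - x := by linarith [hx.2]
  have h2 : 0 < x - 0 := by linarith [hx.1]
  positivity

/-- Substitute t = s + (T-s)x. -/
theorem integral_pow_div_rpow {α s T : ℝ} (hsT : s < T) (m : ℕ) :
    ∫ t in s..T, (T - t) ^ m / (t - s) ^ (1 - α) = (T - s) ^ ((m : ℝ) + α) * betaConst α m := by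
  have hc : 0 < T - s := by linarith
  have h := intervalIntegral.mul_integral_comp_mul_add (a := 0) (b := 1)
    (f := fun t => (T - t) ^ m / (t - s) ^ (1 - α)) (T - s) s
  simp only [mul_zero, zero_add, mul_one, sub_add_cancel] at h
  rw [← h, betaConst]
  have e : (T - s) ^ ((m : ℝ) + α) = (T - s) * ((T - s) ^ m / (T - s) ^ (1 - α)) := by
    have : (m : ℝ) + α = 1 + (m - (1 - α)) := by ring
    rw [this, Real.rpow_add hc, Real.rpow_sub hc, Real.rpow_one, Real.rpow_natCast]
  rw [e, mul_assoc,
    ← intervalIntegral.integral_const_mul ((T - s) ^ m / (T - s) ^ (1 - α))]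
  congr 1
  refine intervalIntegral.integral_congr fun x hx => ?_
  rw [uIcc_of_le zero_le_one] at hx
  simp only [sub_zero, add_sub_cancel_right]
  rw [Real.mul_rpow hc.le hx.1, div_mul_div_comm, ← mul_pow]
  congr 2; ring

/-- Tonelli on the triangle 0 < s < t < T: integrating first in t gives the Beta integral and the
power (T-s)^{m+α}. It takes the place of fractional integration by parts, and the gain of α in the
exponent is the source of T^{-(1-γ)} in the energy estimate. -/
theorem leftFracIntegral_mul_pow {α T : ℝ} (hα : 0 < α) (m : ℕ) {g : ℝ → ℝ}
    (hg0 : ∀ s, 0 ≤ g s) (hg : IntegrableOn g (Ioo 0 T)) :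
    IntegrableOn (fun t => leftFracIntegral α g t * (T - t) ^ m) (Ioo 0 T) ∧
      ∫ t in Ioo 0 T, leftFracIntegral α g t * (T - t) ^ m =
        (Real.Gamma α)⁻¹ * betaConst α m * ∫ s in Ioo 0 T, g s * (T - s) ^ ((m : ℝ) + α) := by
  set ν : Measure ℝ := volume.restrict (Ioo 0 T) with hν
  -- The indicator of s < t lets both variables range over the whole of (0,T), so that the product
  -- measure applies.
  let H : ℝ × ℝ → ℝ := fun z => g z.2 *
    (Ioi z.2).indicator (fun t => (T - t) ^ m / (t - z.2) ^ (1 - α)) z.1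
  have hHm : AEStronglyMeasurable H (ν.prod ν) := by
    refine (hg.aestronglyMeasurable.comp_snd (μ := ν)).mul ?_
    have : (fun z : ℝ × ℝ => (Ioi z.2).indicator (fun t => (T - t) ^ m / (t - z.2) ^ (1 - α)) z.1) =
        {z : ℝ × ℝ | z.2 < z.1}.indicator
          (fun z => (T - z.1) ^ m / (z.1 - z.2) ^ (1 - α)) := by
      ext z; simp [indicator]
    rw [this]
    refine (Measurable.indicator ?_
      (measurableSet_lt measurable_snd measurable_fst)).aestronglyMeasurable
    fun_prop
  have hIoo : ∀ᵐ s ∂ν, s ∈ Ioo 0 T := ae_restrict_mem measurableSet_Ioo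
  have hset : ∀ s ∈ Ioo 0 T, Ioi s ∩ Ioo 0 T = Ioo s T := by
    intro s hs; ext t; simp only [mem_inter_iff, mem_Ioi, mem_Ioo]
    exact ⟨fun h => ⟨h.1, h.2.2⟩, fun h => ⟨h.1, hs.1.trans h.1, h.2⟩⟩
  have hint : ∀ s ∈ Ioo 0 T, Integrable (fun t => H (t, s)) ν := by
    intro s hs
    refine Integrable.const_mul (f := (Ioi s).indicator
      fun t => (T - t) ^ m / (t - s) ^ (1 - α)) ?_ (g s)
    rw [integrable_indicator_iff measurableSet_Ioi, IntegrableOn, hν,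
      Measure.restrict_restrict measurableSet_Ioi, hset s hs]
    exact ((intervalIntegrable_iff_integrableOn_Ioo_of_le hs.2.le).1
      (intervalIntegrable_pow_div_rpow hα hs.2.le m))
  have hval : ∀ s ∈ Ioo 0 T, ∫ t, H (t, s) ∂ν = g s * (T - s) ^ ((m : ℝ) + α) * betaConst α m := by
    intro s hs
    change ∫ t, g s * (Ioi s).indicator (fun t => (T - t) ^ m / (t - s) ^ (1 - α)) t ∂ν = _
    rw [integral_const_mul, integral_indicator measurableSet_Ioi, hν,
      Measure.restrict_restrict measurableSet_Ioi, hset s hs, ← integral_Ioc_eq_integral_Ioo,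
      ← intervalIntegral.integral_of_le hs.2.le, integral_pow_div_rpow hs.2, mul_assoc]
  have hH0 : ∀ s, ∀ t ∈ Ioo 0 T, 0 ≤ H (t, s) := by
    intro s t ht
    refine mul_nonneg (hg0 s) (indicator_apply_nonneg fun hr => ?_)
    have h1 : 0 ≤ T - t := by linarith [ht.2]
    have h2 : 0 ≤ t - s := sub_nonneg.2 (le_of_lt hr)
    positivity
  have hH : Integrable H (ν.prod ν) := by
    rw [integrable_prod_iff' hHm]
    refine ⟨hIoo.mono hint, ?_⟩
    have h1 : Integrable (fun s => g s * (T - s) ^ ((m : ℝ) + α) * betaConst α m) ν := by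
      refine Integrable.mul_const ?_ _
      refine Integrable.mul_bdd (c := T ^ ((m : ℝ) + α)) hg
        (by fun_prop (disch := positivity)) ?_
      filter_upwards [hIoo] with s hs
      have : 0 ≤ T - s := by linarith [hs.2]
      rw [Real.norm_eq_abs, abs_of_nonneg (by positivity)]
      exact Real.rpow_le_rpow this (by linarith [hs.1]) (by positivity)
    refine h1.congr ?_
    filter_upwards [hIoo] with s hs
    rw [← hval s hs]
    refine integral_congr_ae ?_
    filter_upwards [hIoo] with t ht
    rw [Real.norm_eq_abs, abs_of_nonneg (hH0 s t ht)]
  have hfrac : ∀ t ∈ Ioo 0 T, (Real.Gamma α)⁻¹ * ∫ s, H (t, s) ∂ν =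
      leftFracIntegral α g t * (T - t) ^ m := by
    intro t ht
    rw [leftFracIntegral, mul_assoc]
    congr 1
    have e : (fun s => H (t, s)) =
        (Iio t).indicator fun s => g s / (t - s) ^ (1 - α) * (T - t) ^ m := by
      ext s
      by_cases h : s < t
      · simp [H, h]; ring
      · simp [H, h]
    have hs : Iio t ∩ Ioo 0 T = Ioo 0 t := by
      ext s; simp only [mem_inter_iff, mem_Iio, mem_Ioo]
      exact ⟨fun h => ⟨h.2.1, h.1⟩, fun h => ⟨h.2, h.1, h.2.trans ht.2⟩⟩
    rw [e, integral_indicator measurableSet_Iio, hν, Measure.restrict_restrict measurableSet_Iio,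
      hs, integral_mul_const, intervalIntegral.integral_of_le ht.1.le,
      integral_Ioc_eq_integral_Ioo]
  have hae : (fun t => (Real.Gamma α)⁻¹ * ∫ s, H (t, s) ∂ν) =ᵐ[ν]
      fun t => leftFracIntegral α g t * (T - t) ^ m := hIoo.mono hfrac
  refine ⟨(hH.integral_prod_left.const_mul _).congr hae, ?_⟩
  rw [← integral_congr_ae hae, integral_const_mul, integral_integral_swap hH,
    integral_congr_ae (hIoo.mono hval), integral_mul_const]
  ring

/-! ### A vanishing criterion -/

theorem exists_young_constant {p p' ε : ℝ} (h : p.HolderConjugate p') (hε : 0 < ε) :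
    ∃ K : ℝ, 0 ≤ K ∧ ∀ a b : ℝ, 0 ≤ a → 0 ≤ b → a * b ≤ ε * a ^ p + K * b ^ p' := by
  have hp : 0 < p := h.pos
  have hp' : 0 < p' := h.symm.pos
  -- Young's inequality for δa and b/δ has first term δ^p a^p / p, which equals ε a^p for this δ.
  have hδ : 0 < (ε * p) ^ (1 / p) := by positivity
  set δ := (ε * p) ^ (1 / p) with hδd
  have e1 : δ ^ p = ε * p := by
    rw [hδd, ← Real.rpow_mul (by positivity), one_div_mul_cancel hp.ne', Real.rpow_one]
  refine ⟨(1 / δ) ^ p' / p', by positivity, fun a b ha hb => ?_⟩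
  have := Real.young_inequality_of_nonneg (a := δ * a) (b := 1 / δ * b) (by positivity)
    (by positivity) h
  rw [Real.mul_rpow hδ.le ha, Real.mul_rpow (by positivity) hb, e1] at this
  calc a * b = δ * a * (1 / δ * b) := by field_simp
    _ ≤ _ := this
    _ = _ := by field_simp

theorem le_one_add_rpow {a p : ℝ} (ha : 0 ≤ a) (hp : 1 ≤ p) : a ≤ 1 + a ^ p := by
  rcases le_total a 1 with h | h
  · have : 0 ≤ a ^ p := by positivity
    linarith
  · have := Real.rpow_le_rpow_of_exponent_le h hp
    rw [Real.rpow_one] at this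
    linarith

theorem rpow_one_sub_div_mem {X : Type*} {τ : X → ℝ} {z : X} {T r : ℝ} (hT : 0 < T) (hr : 0 ≤ r)
    (hz : z ∈ τ ⁻¹' Ioo 0 T) : 0 ≤ (1 - τ z / T) ^ r ∧ (1 - τ z / T) ^ r ≤ 1 := by
  have h1 : τ z / T ≤ 1 := (div_le_one hT).2 hz.2.le
  have h2 : 0 ≤ τ z / T := div_nonneg hz.1.le hT.le
  exact ⟨Real.rpow_nonneg (by linarith) _, Real.rpow_le_one (by linarith) (by linarith) hr⟩

section Vanishing

variable {X : Type*} [MeasurableSpace X] {ν : Measure X} {τ : X → ℝ} {f W : X → ℝ}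
  {p p' β C D κ : ℝ}

/-- Since a ≤ 1 + a^p, the product fW is dominated by W + f^p W. In the application τ is time, f =
|u| and W = χ. -/
theorem integrableOn_mul_weight (hf0 : ∀ z, 0 ≤ f z) (hW0 : ∀ z, 0 ≤ W z)
    (hp : 1 ≤ p) {T : ℝ} (hfm : AEStronglyMeasurable f (ν.restrict (τ ⁻¹' Ioo 0 T)))
    (hW : IntegrableOn W (τ ⁻¹' Ioo 0 T) ν)
    (hfp : IntegrableOn (fun z => f z ^ p * W z) (τ ⁻¹' Ioo 0 T) ν) :
    IntegrableOn (fun z => f z * W z) (τ ⁻¹' Ioo 0 T) ν := by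
  refine (hW.add hfp).mono' (hfm.mul hW.aestronglyMeasurable) (.of_forall fun z => ?_)
  rw [Real.norm_eq_abs, abs_of_nonneg (mul_nonneg (hf0 z) (hW0 z))]
  have := mul_le_mul_of_nonneg_right (le_one_add_rpow (hf0 z) hp) (hW0 z)
  simp only [Pi.add_apply]
  linarith

theorem integrableOn_mul_rpow_one_sub (hτ : Measurable τ) {g : X → ℝ} {T r : ℝ} (hT : 0 < T)
    (hr : 0 ≤ r) (hg : IntegrableOn g (τ ⁻¹' Ioo 0 T) ν) :
    IntegrableOn (fun z => g z * (1 - τ z / T) ^ r) (τ ⁻¹' Ioo 0 T) ν := by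
  refine Integrable.mul_bdd (c := 1) hg (by fun_prop) ?_
  filter_upwards [ae_restrict_mem (hτ measurableSet_Ioo)] with z hz
  have := rpow_one_sub_div_mem hT hr hz
  rw [Real.norm_eq_abs, abs_of_nonneg this.1]
  exact this.2

/-- If the energies `∫_{0<τ<T} f^p (1-τ/T)^β W` are controlled by
`T^{-1/p'} (∫_{0<τ<T} f (1-τ/T)^{β/p} W + D)` and the slabs `0 < τ < T` have `W`-volume `O(T)`,
then `f` vanishes. -/
theorem setIntegral_rpow_eq_zero_of_energy_estimate (hτ : Measurable τ) (hf0 : ∀ z, 0 ≤ f z)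
    (hW0 : ∀ z, 0 ≤ W z) (hpp : p.HolderConjugate p') (hβ : 0 ≤ β) (hC : 0 ≤ C)
    (hD : 0 ≤ D) (hκ : 0 ≤ κ)
    (hfm : ∀ T, 0 < T → AEStronglyMeasurable f (ν.restrict (τ ⁻¹' Ioo 0 T)))
    (hW : ∀ T, 0 < T → IntegrableOn W (τ ⁻¹' Ioo 0 T) ν)
    (hWκ : ∀ T, 0 < T → ∫ z in τ ⁻¹' Ioo 0 T, W z ∂ν ≤ κ * T)
    (hfp : ∀ T, 0 < T → IntegrableOn (fun z => f z ^ p * W z) (τ ⁻¹' Ioo 0 T) ν)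
    (hmain : ∀ T, 1 ≤ T →
      ∫ z in τ ⁻¹' Ioo 0 T, f z ^ p * W z * (1 - τ z / T) ^ β ∂ν ≤
        C * T ^ (-(1 / p')) * ((∫ z in τ ⁻¹' Ioo 0 T, f z * W z * (1 - τ z / T) ^ (β / p) ∂ν) + D))
    {A₀ : ℝ} (hA₀ : 0 < A₀) :
    ∫ z in τ ⁻¹' Ioo 0 A₀, f z ^ p * W z ∂ν = 0 := by
  have hp : 1 < p := hpp.lt
  have hp0 : 0 < p := hpp.pos
  have hp'0 : 0 < p' := hpp.symm.pos
  have hmeas : ∀ T : ℝ, MeasurableSet (τ ⁻¹' Ioo 0 T) := fun T => hτ measurableSet_Ioo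
  have hfW : ∀ T, 0 < T → IntegrableOn (fun z => f z * W z) (τ ⁻¹' Ioo 0 T) ν := fun T hT =>
    integrableOn_mul_weight hf0 hW0 hp.le (hfm T hT) (hW T hT) (hfp T hT)
  -- The p'-th power of T^{-1/p'} is T⁻¹, which balances the volume κT of the slab.
  have hTp : ∀ T : ℝ, 0 < T → ∀ c : ℝ, 0 ≤ c → (c * T ^ (-(1 / p'))) ^ p' = c ^ p' * T⁻¹ := by
    intro T hT c hc
    rw [Real.mul_rpow hc (by positivity), ← Real.rpow_mul hT.le]
    congr 1
    rw [← Real.rpow_neg_one]; congr 1; field_simp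
  have hF0 : ∀ z, 0 ≤ f z ^ p * W z := fun z => mul_nonneg (Real.rpow_nonneg (hf0 z) _) (hW0 z)
  -- the energy controls the integral over half of the slab
  have hhalf : ∀ A T, 0 < A → 2 * A ≤ T → ∫ z in τ ⁻¹' Ioo 0 A, f z ^ p * W z ∂ν ≤
      2 ^ β * ∫ z in τ ⁻¹' Ioo 0 T, f z ^ p * W z * (1 - τ z / T) ^ β ∂ν := by
    intro A T hA hT
    have hT0 : 0 < T := by linarith
    have hsub : τ ⁻¹' Ioo 0 A ⊆ τ ⁻¹' Ioo 0 T :=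
      preimage_mono (Ioo_subset_Ioo_right (by linarith))
    have hi := integrableOn_mul_rpow_one_sub hτ hT0 hβ (hfp T hT0)
    calc ∫ z in τ ⁻¹' Ioo 0 A, f z ^ p * W z ∂ν
        ≤ ∫ z in τ ⁻¹' Ioo 0 A, 2 ^ β * (f z ^ p * W z * (1 - τ z / T) ^ β) ∂ν := by
          refine setIntegral_mono_on (hfp A hA) ((hi.mono_set hsub).const_mul _) (hmeas A) ?_
          intro z hz
          have h1 : 1 ≤ 2 ^ β * (1 - τ z / T) ^ β := by
            have h2 : τ z / T ≤ 1 / 2 := by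
              rw [div_le_iff₀ hT0]; linarith [hz.2]
            rw [← Real.mul_rpow (by norm_num) (by linarith)]
            exact Real.one_le_rpow (by linarith) hβ
          calc f z ^ p * W z = f z ^ p * W z * 1 := (mul_one _).symm
            _ ≤ f z ^ p * W z * (2 ^ β * (1 - τ z / T) ^ β) :=
              mul_le_mul_of_nonneg_left h1 (hF0 z)
            _ = _ := by ring
      _ = 2 ^ β * ∫ z in τ ⁻¹' Ioo 0 A, f z ^ p * W z * (1 - τ z / T) ^ β ∂ν :=
          integral_const_mul _ _
      _ ≤ _ := by
          refine mul_le_mul_of_nonneg_left ?_ (by positivity)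
          refine setIntegral_mono_set hi ?_ hsub.eventuallyLE
          filter_upwards [ae_restrict_mem (hmeas T)] with z hz
          exact mul_nonneg (hF0 z) (rpow_one_sub_div_mem hT0 hβ hz).1
  -- the energies are bounded
  obtain ⟨K₁, hK₁⟩ : ∃ K₁ : ℝ, ∀ T, 1 ≤ T →
      ∫ z in τ ⁻¹' Ioo 0 T, f z ^ p * W z * (1 - τ z / T) ^ β ∂ν ≤ K₁ := by
    -- With ε = 1/2 half of the energy is absorbed on the left. This is legitimate because the
    -- energy is finite.
    obtain ⟨K, hK0, hK⟩ := exists_young_constant hpp (ε := 1 / 2) (by norm_num)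
    refine ⟨2 * (K * C ^ p' * κ + C * D), fun T hT => ?_⟩
    have hT0 : 0 < T := by linarith
    have hi := integrableOn_mul_rpow_one_sub hτ hT0 hβ (hfp T hT0)
    have hi1 := integrableOn_mul_rpow_one_sub hτ hT0 (r := β / p) (by positivity) (hfW T hT0)
    have h1 : C * T ^ (-(1 / p')) * ∫ z in τ ⁻¹' Ioo 0 T, f z * W z * (1 - τ z / T) ^ (β / p) ∂ν ≤
        1 / 2 * (∫ z in τ ⁻¹' Ioo 0 T, f z ^ p * W z * (1 - τ z / T) ^ β ∂ν) +
          K * C ^ p' * T⁻¹ * ∫ z in τ ⁻¹' Ioo 0 T, W z ∂ν := by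
      rw [← integral_const_mul, ← integral_const_mul, ← integral_const_mul,
        ← integral_add (hi.const_mul _) ((hW T hT0).const_mul _)]
      refine setIntegral_mono_on (hi1.const_mul _) ((hi.const_mul _).add ((hW T hT0).const_mul _))
        (hmeas T) fun z hz => ?_
      have hρ := rpow_one_sub_div_mem (r := 1) hT0 zero_le_one hz
      rw [Real.rpow_one] at hρ
      have h2 := hK (f z * (1 - τ z / T) ^ (β / p)) (C * T ^ (-(1 / p')))
        (mul_nonneg (hf0 z) (Real.rpow_nonneg hρ.1 _)) (by positivity)
      rw [hTp T hT0 C hC, Real.mul_rpow (hf0 z) (Real.rpow_nonneg hρ.1 _), ← Real.rpow_mul hρ.1,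
        div_mul_cancel₀ _ hp0.ne'] at h2
      have h3 := mul_le_mul_of_nonneg_right h2 (hW0 z)
      calc _ = f z * (1 - τ z / T) ^ (β / p) * (C * T ^ (-(1 / p'))) * W z := by ring
        _ ≤ _ := h3
        _ = _ := by ring
    have h2 : K * C ^ p' * T⁻¹ * ∫ z in τ ⁻¹' Ioo 0 T, W z ∂ν ≤ K * C ^ p' * κ := by
      calc _ ≤ K * C ^ p' * T⁻¹ * (κ * T) :=
            mul_le_mul_of_nonneg_left (hWκ T hT0) (by positivity)
        _ = _ := by field_simp
    have h3 : C * T ^ (-(1 / p')) * D ≤ C * D := by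
      have : T ^ (-(1 / p')) ≤ 1 :=
        Real.rpow_le_one_of_one_le_of_nonpos hT (by have : 0 < 1 / p' := by positivity
                                                    linarith)
      have := mul_le_mul_of_nonneg_left this hC
      have := mul_le_mul_of_nonneg_right this hD
      linarith
    have h4 := hmain T hT
    rw [mul_add] at h4
    linarith
  -- the integrals over slabs are bounded and increasing, hence Cauchy
  have hJmono : ∀ A T, 0 < A → A ≤ T → ∫ z in τ ⁻¹' Ioo 0 A, f z ^ p * W z ∂ν ≤
      ∫ z in τ ⁻¹' Ioo 0 T, f z ^ p * W z ∂ν := by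
    intro A T hA hAT
    exact setIntegral_mono_set (hfp T (by linarith)) (.of_forall fun z => hF0 z)
      (preimage_mono (Ioo_subset_Ioo_right hAT)).eventuallyLE
  have htail : ∀ δ : ℝ, 0 < δ → ∃ A, 0 < A ∧ ∀ T, A ≤ T →
      ∫ z in τ ⁻¹' Ioo 0 T, f z ^ p * W z ∂ν ≤ (∫ z in τ ⁻¹' Ioo 0 A, f z ^ p * W z ∂ν) + δ := by
    intro δ hδ
    set S : Set ℝ := (fun A => ∫ z in τ ⁻¹' Ioo 0 A, f z ^ p * W z ∂ν) '' Ioi 0 with hS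
    have hbdd : BddAbove S := by
      refine ⟨2 ^ β * K₁, ?_⟩
      rintro _ ⟨A, hA, rfl⟩
      refine (hhalf A (max 1 (2 * A)) hA (le_max_right _ _)).trans ?_
      exact mul_le_mul_of_nonneg_left (hK₁ _ (le_max_left _ _)) (by positivity)
    have hne : S.Nonempty := ⟨_, 1, mem_Ioi.2 one_pos, rfl⟩
    obtain ⟨_, ⟨A, hA, rfl⟩, hlt⟩ := exists_lt_of_lt_csSup hne (sub_lt_self (sSup S) hδ)
    refine ⟨A, hA, fun T hT => ?_⟩
    have : ∫ z in τ ⁻¹' Ioo 0 T, f z ^ p * W z ∂ν ≤ sSup S :=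
      le_csSup hbdd ⟨T, lt_of_lt_of_le hA hT, rfl⟩
    simp only at hlt
    linarith
  -- the energies tend to zero
  have hsmall : ∀ δ : ℝ, 0 < δ → ∃ T₁, ∀ T, T₁ ≤ T →
      ∫ z in τ ⁻¹' Ioo 0 T, f z ^ p * W z * (1 - τ z / T) ^ β ∂ν ≤ (κ + 2) * δ := by
    intro δ hδ
    -- The roles are now exchanged: the small coefficient falls on the volume term and the large K
    -- on the tail of f^p W, so A is chosen after K. The + 1 in the denominator covers K C^p = 0.
    obtain ⟨K, hK0, hK⟩ := exists_young_constant hpp.symm hδ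
    obtain ⟨A, hA, hAt⟩ := htail (δ / (K * C ^ p + 1)) (by positivity)
    set Q := C * ((∫ z in τ ⁻¹' Ioo 0 A, f z * W z ∂ν) + D) with hQ
    have hQ0 : 0 ≤ Q := mul_nonneg hC (add_nonneg
      (integral_nonneg fun z => mul_nonneg (hf0 z) (hW0 z)) hD)
    have hlim : Filter.Tendsto (fun T : ℝ => Q * T ^ (-(1 / p'))) Filter.atTop (nhds 0) := by
      simpa using (tendsto_rpow_neg_atTop (y := 1 / p') (by positivity)).const_mul Q
    obtain ⟨T₂, hT₂⟩ := Filter.eventually_atTop.1 (hlim.eventually (ge_mem_nhds hδ))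
    refine ⟨max (max 1 A) T₂, fun T hT => ?_⟩
    have hT1 : 1 ≤ T := (le_max_left _ _).trans ((le_max_left _ _).trans hT)
    have hTA : A ≤ T := (le_max_right _ _).trans ((le_max_left _ _).trans hT)
    have hTT₂ : T₂ ≤ T := (le_max_right _ _).trans hT
    have hT0 : 0 < T := by linarith
    have hsub : τ ⁻¹' Ioo 0 A ⊆ τ ⁻¹' Ioo 0 T := preimage_mono (Ioo_subset_Ioo_right hTA)
    set R := τ ⁻¹' Ioo 0 T \ τ ⁻¹' Ioo 0 A with hR
    have hRm : MeasurableSet R := (hmeas T).diff (hmeas A)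
    have hRsub : R ⊆ τ ⁻¹' Ioo 0 T := sdiff_subset
    have h1 : ∫ z in τ ⁻¹' Ioo 0 T, f z * W z * (1 - τ z / T) ^ (β / p) ∂ν ≤
        ∫ z in τ ⁻¹' Ioo 0 T, f z * W z ∂ν := by
      refine setIntegral_mono_on
        (integrableOn_mul_rpow_one_sub hτ hT0 (by positivity) (hfW T hT0)) (hfW T hT0) (hmeas T) ?_
      intro z hz
      exact mul_le_of_le_one_right (mul_nonneg (hf0 z) (hW0 z))
        (rpow_one_sub_div_mem hT0 (by positivity) hz).2
    have h2 : ∫ z in τ ⁻¹' Ioo 0 T, f z * W z ∂ν =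
        (∫ z in τ ⁻¹' Ioo 0 A, f z * W z ∂ν) + ∫ z in R, f z * W z ∂ν := by
      rw [hR, setIntegral_sdiff (hmeas A) (hfW T hT0) hsub]; ring
    have h3 : C * T ^ (-(1 / p')) * ∫ z in R, f z * W z ∂ν ≤
        K * C ^ p * (∫ z in R, f z ^ p * W z ∂ν) + δ * T⁻¹ * ∫ z in R, W z ∂ν := by
      have i1 := (hfp T hT0).mono_set hRsub
      have i2 := (hW T hT0).mono_set hRsub
      rw [← integral_const_mul, ← integral_const_mul, ← integral_const_mul,
        ← integral_add (i1.const_mul _) (i2.const_mul _)]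
      refine setIntegral_mono_on (((hfW T hT0).mono_set hRsub).const_mul _)
        ((i1.const_mul _).add (i2.const_mul _)) hRm fun z _ => ?_
      have h2 := hK (1 * T ^ (-(1 / p'))) (C * f z) (by positivity) (mul_nonneg hC (hf0 z))
      rw [hTp T hT0 1 zero_le_one, Real.mul_rpow hC (hf0 z), Real.one_rpow] at h2
      have h3 := mul_le_mul_of_nonneg_right h2 (hW0 z)
      calc _ = 1 * T ^ (-(1 / p')) * (C * f z) * W z := by ring
        _ ≤ _ := h3
        _ = _ := by ring
    have h4 : K * C ^ p * ∫ z in R, f z ^ p * W z ∂ν ≤ δ := by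
      rw [hR, setIntegral_sdiff (hmeas A) (hfp T hT0) hsub]
      have h5 := hAt T hTA
      have h6 : (∫ z in τ ⁻¹' Ioo 0 T, f z ^ p * W z ∂ν) - ∫ z in τ ⁻¹' Ioo 0 A, f z ^ p * W z ∂ν ≤
          δ / (K * C ^ p + 1) := by linarith
      have h7 : 0 ≤ K * C ^ p := by positivity
      refine (mul_le_mul_of_nonneg_left h6 h7).trans ?_
      rw [← mul_div_assoc, div_le_iff₀ (by positivity)]
      nlinarith
    have h5 : δ * T⁻¹ * ∫ z in R, W z ∂ν ≤ κ * δ := by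
      have : ∫ z in R, W z ∂ν ≤ κ * T :=
        (setIntegral_mono_set (hW T hT0) (.of_forall fun z => hW0 z) hRsub.eventuallyLE).trans
          (hWκ T hT0)
      calc _ ≤ δ * T⁻¹ * (κ * T) := mul_le_mul_of_nonneg_left this (by positivity)
        _ = _ := by field_simp
    have h6 : Q * T ^ (-(1 / p')) ≤ δ := hT₂ T hTT₂
    have hpos : 0 ≤ C * T ^ (-(1 / p')) := by positivity
    -- The three contributions are the fixed slab with the data (δ), the tail (δ) and the volume
    -- (κδ).
    calc _ ≤ _ := hmain T hT1
      _ ≤ C * T ^ (-(1 / p')) * ((∫ z in τ ⁻¹' Ioo 0 T, f z * W z ∂ν) + D) := by gcongr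
      _ = Q * T ^ (-(1 / p')) + C * T ^ (-(1 / p')) * ∫ z in R, f z * W z ∂ν := by
          rw [h2, hQ]; ring
      _ ≤ (κ + 2) * δ := by linarith
  refine le_antisymm (le_of_forall_pos_le_add fun ε hε => ?_) (integral_nonneg hF0)
  obtain ⟨T₁, hT₁⟩ := hsmall (ε / (2 ^ β * (κ + 2))) (by positivity)
  have h1 := hhalf A₀ (max T₁ (2 * A₀)) hA₀ (le_max_right _ _)
  have h2 := hT₁ (max T₁ (2 * A₀)) (le_max_left _ _)
  have h3 := mul_le_mul_of_nonneg_left h2 (by positivity : (0 : ℝ) ≤ 2 ^ β)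
  refine h1.trans (h3.trans (le_of_eq ?_))
  field_simp
  ring

end Vanishing

/-! ### The weak formulation tested against `ψ(x) (T - t)^m` -/

theorem derivWithin_const_mul_sub_pow {T : ℝ} (hT : 0 < T) (c : ℝ) (k : ℕ) {t : ℝ}
    (ht : t ∈ Icc 0 T) :
    derivWithin (fun t => c * (T - t) ^ (k + 1)) (Icc 0 T) t = -(c * (k + 1) * (T - t) ^ k) := by
  have h : HasDerivAt (fun t => c * (T - t) ^ (k + 1)) (-(c * (k + 1) * (T - t) ^ k)) t := by
    have := (((hasDerivAt_id t).const_sub T).pow (k + 1)).const_mul c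
    convert! this using 1
    simp; ring
  exact h.hasDerivWithinAt.derivWithin (uniqueDiffOn_Icc hT t ht)

section Energy

variable {N : ℕ} {σ η μ γ p T : ℝ} {u₀ u₁ : EuclideanSpace ℝ (Fin N) → ℝ}
  {u : ℝ → EuclideanSpace ℝ (Fin N) → ℝ} {ψ : EuclideanSpace ℝ (Fin N) → ℝ}

/-- The exponent k+2 makes φ and φ' vanish at T for every k. -/
theorem IsWeakSolutionOn.weak_form_pow (hT : 0 < T) (hu : IsWeakSolutionOn σ η μ γ p u₀ u₁ T u)
    (hψ : ContDiff ℝ ∞ ψ) (hψc : HasCompactSupport ψ) (k : ℕ) :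
    ∫ x, ∫ t in Ioo 0 T,
        (leftFracIntegral (1 - γ) (fun s => |u s x| ^ p) t * (ψ x * (T - t) ^ (k + 2))
          + (u₀ x + t * u₁ x) * (ψ x * ((k + 2) * (k + 1) * (T - t) ^ k))
          + μ * u₀ x * (fracLaplacian η ψ x * ((k + 2) * (T - t) ^ (k + 1))))
      = (∫ x, ∫ t in Ioo 0 T, u t x * (fracLaplacian σ ψ x * (T - t) ^ (k + 2)))
        + ∫ x, ∫ t in Ioo 0 T,
            u t x * (ψ x * ((k + 2) * (k + 1) * (T - t) ^ k)
              + μ * (fracLaplacian η ψ x * ((k + 2) * (T - t) ^ (k + 1)))) := by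
  have hd1 : ∀ t ∈ Icc 0 T, derivWithin (fun t => (T - t) ^ (k + 2)) (Icc 0 T) t =
      -(k + 2 : ℝ) * (T - t) ^ (k + 1) := by
    intro t ht
    have := derivWithin_const_mul_sub_pow hT 1 (k + 1) ht
    simp only [one_mul] at this
    rw [this]; push_cast; ring
  have hd2 : ∀ t ∈ Icc 0 T,
      derivWithin (derivWithin (fun t => (T - t) ^ (k + 2)) (Icc 0 T)) (Icc 0 T) t =
      (k + 2) * (k + 1) * (T - t) ^ k := by
    intro t ht
    rw [derivWithin_congr (fun s hs => hd1 s hs) (hd1 t ht),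
      derivWithin_const_mul_sub_pow hT _ k ht]
    ring
  have hend : T ∈ Icc 0 T := ⟨hT.le, le_rfl⟩
  have key := hu.weak_form ψ (fun t => (T - t) ^ (k + 2)) _ _ hψ hψc
    (ContDiff.contDiffOn (by fun_prop)) rfl rfl (by simp) (by rw [hd1 T hend]; simp)
  have conv : ∀ g h : ℝ → ℝ, (∀ t ∈ Icc 0 T, g t = h t) →
      ∫ t in (0 : ℝ)..T, g t = ∫ t in Ioo 0 T, h t := by
    intro g h hgh
    rw [intervalIntegral.integral_of_le hT.le, integral_Ioc_eq_integral_Ioo]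
    exact setIntegral_congr_fun measurableSet_Ioo fun t ht => hgh t (Ioo_subset_Icc_self ht)
  convert! key using 1
  · refine integral_congr_ae (.of_forall fun x => ?_)
    refine (conv _ _ fun t ht => ?_).symm
    rw [hd1 t ht, hd2 t ht]; ring
  · congr 1
    · exact integral_congr_ae (.of_forall fun x => (conv _ _ fun t ht => rfl).symm)
    · refine integral_congr_ae (.of_forall fun x => ?_)
      refine (conv _ _ fun t ht => ?_).symm
      rw [hd1 t ht, hd2 t ht]; ring

/-- An iterated integral is dominated by the integral over the product of an integrable
majorant. -/
theorem abs_iterated_integral_le {h : EuclideanSpace ℝ (Fin N) → ℝ → ℝ}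
    {G : ℝ × EuclideanSpace ℝ (Fin N) → ℝ}
    (hG : Integrable G (volume.restrict (Ioo 0 T ×ˢ univ)))
    (hh : ∀ x, ∀ t ∈ Ioo 0 T, |h x t| ≤ G (t, x)) :
    |∫ x, ∫ t in Ioo 0 T, h x t| ≤ ∫ z in Ioo 0 T ×ˢ univ, G z := by
  have hm : (volume.restrict (Ioo 0 T ×ˢ univ) : Measure (ℝ × EuclideanSpace ℝ (Fin N))) =
      (volume.restrict (Ioo 0 T)).prod volume := by
    rw [Measure.volume_eq_prod, ← Measure.prod_restrict, Measure.restrict_univ]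
  rw [hm] at hG ⊢
  rw [integral_prod_symm _ hG, ← Real.norm_eq_abs]
  -- Only the majorant has to be integrable: an integral of h that fails to exist is 0 by convention
  -- and satisfies the bound as well.
  refine norm_integral_le_of_norm_le hG.integral_prod_right ?_
  filter_upwards [hG.prod_left_ae] with x hx
  refine norm_integral_le_of_norm_le hx ?_
  filter_upwards [ae_restrict_mem measurableSet_Ioo] with t ht
  exact hh x t ht

theorem integrable_mul_of_abs_le_mul {X : Type*} [MeasurableSpace X] {ν : Measure X}
    {f L χ : X → ℝ} {C : ℝ} (hχ : Measurable χ) (hχ0 : ∀ x, 0 < χ x) (hL : Measurable L)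
    (hLC : ∀ x, |L x| ≤ C * χ x) (hf : Integrable (fun x => f x * χ x) ν) :
    Integrable (fun x => f x * L x) ν := by
  have h : Integrable (fun x => f x * χ x * (L x / χ x)) ν := by
    refine hf.mul_bdd (c := C) (hL.div hχ).aestronglyMeasurable (.of_forall fun x => ?_)
    rw [Real.norm_eq_abs, abs_div, abs_of_pos (hχ0 x), div_le_iff₀ (hχ0 x)]
    exact hLC x
  refine h.congr (.of_forall fun x => ?_)
  have := (hχ0 x).ne'
  field_simp

theorem abs_integral_mul_le {X : Type*} [MeasurableSpace X] {ν : Measure X}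
    {f L χ : X → ℝ} {C : ℝ} (hLC : ∀ x, |L x| ≤ C * χ x)
    (hχ0 : ∀ x, 0 < χ x) (hf : Integrable (fun x => f x * χ x) ν) :
    |∫ x, f x * L x ∂ν| ≤ C * ∫ x, |f x| * χ x ∂ν := by
  rw [← integral_const_mul, ← Real.norm_eq_abs]
  have hf' : Integrable (fun x => |f x| * χ x) ν := by
    refine hf.abs.congr (.of_forall fun x => ?_)
    simp only [abs_mul, abs_of_pos (hχ0 x)]
  refine norm_integral_le_of_norm_le (hf'.const_mul C) (.of_forall fun x => ?_)
  rw [Real.norm_eq_abs, abs_mul]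
  calc |f x| * |L x| ≤ |f x| * (C * χ x) := mul_le_mul_of_nonneg_left (hLC x) (abs_nonneg _)
    _ = _ := by ring

theorem abs_setIntegral_Ioo_le {g : ℝ → ℝ} {K : ℝ} (hT : 0 < T) (hg : ∀ t ∈ Ioo 0 T, |g t| ≤ K) :
    |∫ t in Ioo 0 T, g t| ≤ K * T := by
  have := norm_setIntegral_le_of_norm_le_const (μ := volume) (s := Ioo 0 T) (f := g) (C := K)
    (by simp) (fun t ht => hg t ht)
  simpa [Real.volume_real_Ioo_of_le hT.le] using this

end Energy

/-! ### The energy estimate for weak solutions -/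

section EnergyEstimate

variable {N : ℕ} {σ η μ γ p q T : ℝ} {u₀ u₁ : EuclideanSpace ℝ (Fin N) → ℝ}
  {u : ℝ → EuclideanSpace ℝ (Fin N) → ℝ} {ψ : EuclideanSpace ℝ (Fin N) → ℝ}

theorem volume_restrict_Ioo_prod_univ (N : ℕ) (T : ℝ) :
    (volume.restrict (Ioo 0 T ×ˢ univ) : Measure (ℝ × EuclideanSpace ℝ (Fin N))) =
      (volume.restrict (Ioo 0 T)).prod volume := by
  rw [Measure.volume_eq_prod, ← Measure.prod_restrict, Measure.restrict_univ]

theorem integral_add_add_add {X : Type*} [MeasurableSpace X] {ν : Measure X} {a b c d : X → ℝ}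
    (ha : Integrable a ν) (hb : Integrable b ν) (hc : Integrable c ν) (hd : Integrable d ν) :
    ∫ x, (a x + b x + c x + d x) ∂ν =
      (∫ x, a x ∂ν) + (∫ x, b x ∂ν) + (∫ x, c x ∂ν) + ∫ x, d x ∂ν := by
  rw [integral_add (f := fun x => a x + b x + c x) ((ha.add hb).add hc) hd,
    integral_add (f := fun x => a x + b x) (ha.add hb) hc, integral_add ha hb]

/-- Write T-t = T(1-t/T). Since T ≥ 1 and r ≤ k, the powers k, k+1, k+2 coming from φ'', φ', φ all
fit under the same majorant. -/
theorem abs_mul_sub_pow_le (hT : 1 ≤ T) {k j : ℕ} (hj : j ≤ 2) {c r : ℝ} (hc0 : 0 ≤ c)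
    (hc : c ≤ ((k : ℝ) + 2) ^ 2) (hrk : r ≤ k) {t : ℝ} (ht : t ∈ Ioo 0 T) :
    |c * (T - t) ^ (k + j)| ≤ (k + 2) ^ 2 * T ^ (k + 2) * (1 - t / T) ^ r := by
  have hT0 : 0 < T := by linarith
  have h1 : t / T < 1 := (div_lt_one hT0).2 ht.2
  have h2 : 0 ≤ t / T := div_nonneg ht.1.le hT0.le
  have e : T - t = T * (1 - t / T) := by field_simp
  have hρ : 0 < 1 - t / T := by linarith
  rw [e, mul_pow, abs_of_nonneg (by positivity), ← mul_assoc]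
  have h3 : (1 - t / T) ^ (k + j) ≤ (1 - t / T) ^ r := by
    rw [← Real.rpow_natCast]
    refine Real.rpow_le_rpow_of_exponent_ge hρ (by linarith) ?_
    push_cast
    linarith [(Nat.cast_nonneg j : (0 : ℝ) ≤ j)]
  have h4 : T ^ (k + j) ≤ T ^ (k + 2) := pow_le_pow_right₀ hT (by omega)
  gcongr

/-- The value of the terms of the weak formulation with the nonlinearity and the data. -/
theorem integral_source_and_data (hγ : γ < 1) (k : ℕ) {Lη : EuclideanSpace ℝ (Fin N) → ℝ}
    (h1 : Integrable fun x => u₀ x * ψ x) (h2 : Integrable fun x => u₁ x * ψ x)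
    (h3 : Integrable fun x => u₀ x * Lη x)
    (hae : ∀ᵐ x, IntegrableOn (fun t => |u t x| ^ p) (Ioo 0 T))
    (h4 : Integrable (fun z : ℝ × EuclideanSpace ℝ (Fin N) =>
      |u z.1 z.2| ^ p * ψ z.2 * (T - z.1) ^ (((k + 2 : ℕ) : ℝ) + (1 - γ)))
      (volume.restrict (Ioo 0 T ×ˢ univ))) :
    ∫ x, ∫ t in Ioo 0 T,
        (leftFracIntegral (1 - γ) (fun s => |u s x| ^ p) t * (ψ x * (T - t) ^ (k + 2))
          + (u₀ x + t * u₁ x) * (ψ x * ((k + 2) * (k + 1) * (T - t) ^ k))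
          + μ * u₀ x * (Lη x * ((k + 2) * (T - t) ^ (k + 1)))) =
      (Real.Gamma (1 - γ))⁻¹ * betaConst (1 - γ) (k + 2) *
        (∫ z in Ioo 0 T ×ˢ univ,
          |u z.1 z.2| ^ p * ψ z.2 * (T - z.1) ^ (((k + 2 : ℕ) : ℝ) + (1 - γ)))
      + (∫ t in Ioo 0 T, ((k : ℝ) + 2) * (k + 1) * (T - t) ^ k) * (∫ x, u₀ x * ψ x)
      + (∫ t in Ioo 0 T, t * (((k : ℝ) + 2) * (k + 1) * (T - t) ^ k)) * (∫ x, u₁ x * ψ x)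
      + μ * (∫ t in Ioo 0 T, ((k : ℝ) + 2) * (T - t) ^ (k + 1)) * (∫ x, u₀ x * Lη x) := by
  set c₀ := (Real.Gamma (1 - γ))⁻¹ * betaConst (1 - γ) (k + 2)
  set c₁ := ∫ t in Ioo 0 T, ((k : ℝ) + 2) * (k + 1) * (T - t) ^ k with hc₁
  set c₂ := ∫ t in Ioo 0 T, t * (((k : ℝ) + 2) * (k + 1) * (T - t) ^ k) with hc₂
  set c₃ := ∫ t in Ioo 0 T, ((k : ℝ) + 2) * (T - t) ^ (k + 1) with hc₃
  set b := ((k + 2 : ℕ) : ℝ) + (1 - γ)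
  have hcont : ∀ g : ℝ → ℝ, Continuous g → IntegrableOn g (Ioo 0 T) := fun g hg =>
    (hg.integrableOn_Icc).mono_set Ioo_subset_Icc_self
  rw [volume_restrict_Ioo_prod_univ] at h4 ⊢
  -- For almost every x the time fibre of |u|^p is integrable, so the fractional integral can be
  -- evaluated against the power before integrating in x.
  have inner : ∀ᵐ x, ∫ t in Ioo 0 T,
        (leftFracIntegral (1 - γ) (fun s => |u s x| ^ p) t * (ψ x * (T - t) ^ (k + 2))
          + (u₀ x + t * u₁ x) * (ψ x * ((k + 2) * (k + 1) * (T - t) ^ k))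
          + μ * u₀ x * (Lη x * ((k + 2) * (T - t) ^ (k + 1)))) =
      c₀ * (∫ t in Ioo 0 T, |u t x| ^ p * ψ x * (T - t) ^ b) + c₁ * (u₀ x * ψ x)
        + c₂ * (u₁ x * ψ x) + μ * c₃ * (u₀ x * Lη x) := by
    filter_upwards [hae] with x hx
    obtain ⟨hi, he⟩ := leftFracIntegral_mul_pow (α := 1 - γ) (by linarith) (k + 2)
      (fun s => by positivity) hx
    have i1 := hcont (fun t => ((k : ℝ) + 2) * (k + 1) * (T - t) ^ k) (by fun_prop)
    have i2 := hcont (fun t => t * (((k : ℝ) + 2) * (k + 1) * (T - t) ^ k)) (by fun_prop)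
    have i3 := hcont (fun t => ((k : ℝ) + 2) * (T - t) ^ (k + 1)) (by fun_prop)
    have e : ∀ t, (leftFracIntegral (1 - γ) (fun s => |u s x| ^ p) t * (ψ x * (T - t) ^ (k + 2))
          + (u₀ x + t * u₁ x) * (ψ x * ((k + 2) * (k + 1) * (T - t) ^ k))
          + μ * u₀ x * (Lη x * ((k + 2) * (T - t) ^ (k + 1)))) =
        ψ x * (leftFracIntegral (1 - γ) (fun s => |u s x| ^ p) t * (T - t) ^ (k + 2))
        + u₀ x * ψ x * (((k : ℝ) + 2) * (k + 1) * (T - t) ^ k)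
        + u₁ x * ψ x * (t * (((k : ℝ) + 2) * (k + 1) * (T - t) ^ k))
        + μ * (u₀ x * Lη x) * (((k : ℝ) + 2) * (T - t) ^ (k + 1)) := fun t => by ring
    have e2 : ∫ t in Ioo 0 T, |u t x| ^ p * ψ x * (T - t) ^ b =
        ψ x * ∫ t in Ioo 0 T, |u t x| ^ p * (T - t) ^ b := by
      rw [← integral_const_mul]
      exact integral_congr_ae (.of_forall fun t => by simp only; ring)
    simp_rw [e]
    rw [integral_add_add_add (hi.const_mul _) (i1.const_mul _) (i2.const_mul _) (i3.const_mul _),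
      integral_const_mul (ψ x), integral_const_mul (u₀ x * ψ x), integral_const_mul (u₁ x * ψ x),
      integral_const_mul (μ * (u₀ x * Lη x)), he, ← hc₁, ← hc₂, ← hc₃, e2]
    ring
  rw [integral_congr_ae inner]
  have i0 : Integrable fun x => c₀ * ∫ t in Ioo 0 T, |u t x| ^ p * ψ x * (T - t) ^ b :=
    h4.integral_prod_right.const_mul c₀
  rw [integral_add_add_add i0 (h1.const_mul _) (h2.const_mul _) (h3.const_mul _),
    integral_const_mul, integral_const_mul, integral_const_mul, integral_const_mul,
    integral_prod_symm _ h4]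

theorem integrable_source_mul {b C : ℝ} (hb0 : 0 ≤ b) (hq : (N : ℝ) < q)
    (hup : Integrable (fun z : ℝ × EuclideanSpace ℝ (Fin N) =>
      |u z.1 z.2| ^ p * decayWeight N q z.2) (volume.restrict (Ioo 0 T ×ˢ univ)))
    (hψm : Measurable ψ) (hψC : ∀ x, |ψ x| ≤ C * decayWeight N q x) :
    Integrable (fun z : ℝ × EuclideanSpace ℝ (Fin N) =>
      |u z.1 z.2| ^ p * ψ z.2 * (T - z.1) ^ b) (volume.restrict (Ioo 0 T ×ˢ univ)) := by
  have hχm : Measurable (decayWeight N q) := (continuous_decayWeight N q).measurable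
  have hχ0 := decayWeight_pos hq
  have hIoo : ∀ᵐ z : ℝ × EuclideanSpace ℝ (Fin N) ∂(volume.restrict (Ioo 0 T ×ˢ univ)),
      z.1 ∈ Ioo 0 T := by
    filter_upwards [ae_restrict_mem (measurableSet_Ioo.prod MeasurableSet.univ)] with z hz
    exact hz.1
  refine Integrable.mul_bdd (c := T ^ b) ?_
    (by fun_prop (disch := positivity)) ?_
  · exact integrable_mul_of_abs_le_mul (χ := fun z : ℝ × EuclideanSpace ℝ (Fin N) =>
      decayWeight N q z.2) (L := fun z => ψ z.2) (by fun_prop) (fun z => hχ0 z.2) (by fun_prop)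
      (fun z => hψC z.2) hup
  · filter_upwards [hIoo] with z hz
    have : 0 ≤ T - z.1 := by linarith [hz.2]
    rw [Real.norm_eq_abs, abs_of_nonneg (by positivity)]
    exact Real.rpow_le_rpow this (by linarith [hz.1]) hb0

/-- The inequality obtained by testing the equation with `ψ(x) (T - t)^{k+2}`. -/
theorem IsWeakSolutionOn.source_le (hT : 1 ≤ T) (hγ : γ < 1) (hq : (N : ℝ) < q)
    (hu : IsWeakSolutionOn σ η μ γ p u₀ u₁ T u)
    (hu₀ : Integrable (fun x => u₀ x * decayWeight N q x))
    (hu₁ : Integrable (fun x => u₁ x * decayWeight N q x))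
    (hup : Integrable (fun z : ℝ × EuclideanSpace ℝ (Fin N) =>
      |u z.1 z.2| ^ p * decayWeight N q z.2) (volume.restrict (Ioo 0 T ×ˢ univ)))
    (hu1 : Integrable (fun z : ℝ × EuclideanSpace ℝ (Fin N) =>
      |u z.1 z.2| * decayWeight N q z.2) (volume.restrict (Ioo 0 T ×ˢ univ)))
    (hψ : ContDiff ℝ ∞ ψ) (hψc : HasCompactSupport ψ) {C : ℝ} (hC0 : 0 ≤ C)
    (hψC : ∀ x, |ψ x| ≤ C * decayWeight N q x)
    (hση : ∀ x, |fracLaplacian σ ψ x| ≤ C * decayWeight N q x)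
    (hηC : ∀ x, |fracLaplacian η ψ x| ≤ C * decayWeight N q x) (k : ℕ) {r : ℝ} (hr0 : 0 ≤ r)
    (hrk : r ≤ k) :
    (Real.Gamma (1 - γ))⁻¹ * betaConst (1 - γ) (k + 2) *
        (∫ z in Ioo 0 T ×ˢ univ,
          |u z.1 z.2| ^ p * ψ z.2 * (T - z.1) ^ (((k + 2 : ℕ) : ℝ) + (1 - γ))) ≤
      C * (2 + |μ|) * (k + 2) ^ 2 * T ^ (k + 2) *
        ((∫ z in Ioo 0 T ×ˢ univ, |u z.1 z.2| * decayWeight N q z.2 * (1 - z.1 / T) ^ r) +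
          ((∫ x, |u₀ x| * decayWeight N q x) + ∫ x, |u₁ x| * decayWeight N q x)) := by
  have hT0 : 0 < T := by linarith
  have hχm : Measurable (decayWeight N q) := (continuous_decayWeight N q).measurable
  have hχ0 := decayWeight_pos hq
  have hψm : Measurable ψ := hψ.continuous.measurable
  have hLη : Measurable (fracLaplacian η ψ) := measurable_fracLaplacian η hψ
  set b := ((k + 2 : ℕ) : ℝ) + (1 - γ) with hb
  have hb0 : 0 ≤ b := by
    have : (0 : ℝ) ≤ ((k + 2 : ℕ) : ℝ) := by positivity
    linarith
  have hae : ∀ᵐ x, IntegrableOn (fun t => |u t x| ^ p) (Ioo 0 T) := by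
    have h := hup
    rw [volume_restrict_Ioo_prod_univ] at h
    filter_upwards [h.prod_left_ae] with x hx
    refine (hx.mul_const (decayWeight N q x)⁻¹).congr (.of_forall fun t => ?_)
    simp only
    rw [mul_assoc, mul_inv_cancel₀ (hχ0 x).ne', mul_one]
  have h4 := integrable_source_mul hb0 hq hup hψm hψC
  have key := hu.weak_form_pow hT0 hψ hψc k
  rw [integral_source_and_data hγ k (integrable_mul_of_abs_le_mul hχm hχ0 hψm hψC hu₀)
    (integrable_mul_of_abs_le_mul hχm hχ0 hψm hψC hu₁)
    (integrable_mul_of_abs_le_mul hχm hχ0 hLη hηC hu₀) hae h4] at key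
  have hk0 : (0 : ℝ) ≤ k := Nat.cast_nonneg k
  set M : ℝ := (k + 2) ^ 2 * T ^ (k + 2) with hM
  have hM0 : 0 ≤ M := by positivity
  have hb0' : ∀ t ∈ Ioo 0 T, |(T - t) ^ (k + 2)| ≤ M * (1 - t / T) ^ r := fun t ht => by
    simpa using abs_mul_sub_pow_le hT (le_refl 2) zero_le_one (by nlinarith) hrk ht
  have hb1' : ∀ t ∈ Ioo 0 T, |((k : ℝ) + 2) * (T - t) ^ (k + 1)| ≤ M * (1 - t / T) ^ r :=
    fun t ht => abs_mul_sub_pow_le hT one_le_two (by positivity) (by nlinarith) hrk ht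
  have hb2' : ∀ t ∈ Ioo 0 T, |((k : ℝ) + 2) * (k + 1) * (T - t) ^ k| ≤ M * (1 - t / T) ^ r :=
    fun t ht => abs_mul_sub_pow_le (j := 0) hT zero_le_two (by positivity) (by nlinarith) hrk ht
  -- the data terms
  have hsub : ∀ (j : ℕ), ∀ t ∈ Ioo 0 T, 0 ≤ (T - t) ^ j ∧ (T - t) ^ j ≤ T ^ j := fun j t ht =>
    ⟨pow_nonneg (by linarith [ht.2]) _,
      pow_le_pow_left₀ (by linarith [ht.2]) (by linarith [ht.1]) _⟩
  have hc₁ : |∫ t in Ioo 0 T, ((k : ℝ) + 2) * (k + 1) * (T - t) ^ k| ≤ M := by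
    refine (abs_setIntegral_Ioo_le (K := (k + 2) ^ 2 * T ^ k) hT0 fun t ht => ?_).trans ?_
    · obtain ⟨h1, h2⟩ := hsub k t ht
      rw [abs_of_nonneg (by positivity)]
      exact mul_le_mul (by nlinarith) h2 h1 (by positivity)
    · rw [hM, mul_assoc, ← pow_succ]
      gcongr
      norm_num
  -- The factor t costs one more power of T, so the u₁ term attains the order T^{k+2}; the u₀ terms
  -- are bounded by it using T ≥ 1 where needed.
  have hc₂ : |∫ t in Ioo 0 T, t * (((k : ℝ) + 2) * (k + 1) * (T - t) ^ k)| ≤ M := by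
    refine (abs_setIntegral_Ioo_le (K := T * ((k + 2) ^ 2 * T ^ k)) hT0 fun t ht => ?_).trans ?_
    · obtain ⟨h1, h2⟩ := hsub k t ht
      have := ht.1.le
      rw [abs_of_nonneg (by positivity)]
      exact mul_le_mul ht.2.le (mul_le_mul (by nlinarith) h2 h1 (by positivity)) (by positivity)
        hT0.le
    · refine le_of_eq ?_
      rw [hM]; ring
  have hc₃ : |∫ t in Ioo 0 T, ((k : ℝ) + 2) * (T - t) ^ (k + 1)| ≤ M := by
    refine (abs_setIntegral_Ioo_le (K := (k + 2) ^ 2 * T ^ (k + 1)) hT0 fun t ht => ?_).trans ?_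
    · obtain ⟨h1, h2⟩ := hsub (k + 1) t ht
      rw [abs_of_nonneg (by positivity)]
      exact mul_le_mul (by nlinarith) h2 h1 (by positivity)
    · refine le_of_eq ?_
      rw [hM]; ring
  have hd₁ := abs_integral_mul_le hψC hχ0 hu₀
  have hd₂ := abs_integral_mul_le hψC hχ0 hu₁
  have hd₃ := abs_integral_mul_le hηC hχ0 hu₀
  set I₀ := ∫ x, |u₀ x| * decayWeight N q x
  set I₁ := ∫ x, |u₁ x| * decayWeight N q x
  have hI₀ : 0 ≤ I₀ := integral_nonneg fun x => mul_nonneg (abs_nonneg _) (hχ0 x).le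
  have hI₁ : 0 ≤ I₁ := integral_nonneg fun x => mul_nonneg (abs_nonneg _) (hχ0 x).le
  -- the solution terms
  have hG : Integrable (fun z : ℝ × EuclideanSpace ℝ (Fin N) =>
      |u z.1 z.2| * decayWeight N q z.2 * (1 - z.1 / T) ^ r)
      (volume.restrict (Ioo 0 T ×ˢ univ)) := by
    have h := hu1
    rw [Set.prod_univ] at h ⊢
    exact integrableOn_mul_rpow_one_sub measurable_fst hT0 hr0 h
  set I := ∫ z in Ioo 0 T ×ˢ univ, |u z.1 z.2| * decayWeight N q z.2 * (1 - z.1 / T) ^ r with hI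
  have hR1 := abs_iterated_integral_le
    (h := fun x t => u t x * (fracLaplacian σ ψ x * (T - t) ^ (k + 2)))
    (hG.const_mul (C * M)) (fun x t ht => by
      rw [abs_mul, abs_mul]
      calc |u t x| * (|fracLaplacian σ ψ x| * |(T - t) ^ (k + 2)|)
          ≤ |u t x| * ((C * decayWeight N q x) * (M * (1 - t / T) ^ r)) := by
            refine mul_le_mul_of_nonneg_left ?_ (abs_nonneg _)
            exact mul_le_mul (hση x) (hb0' t ht) (abs_nonneg _) (mul_nonneg hC0 (hχ0 x).le)
        _ = _ := by ring)
  have hR2 := abs_iterated_integral_le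
    (h := fun x t => u t x * (ψ x * ((k + 2) * (k + 1) * (T - t) ^ k)
              + μ * (fracLaplacian η ψ x * ((k + 2) * (T - t) ^ (k + 1)))))
    (hG.const_mul (C * (1 + |μ|) * M)) (fun x t ht => by
      have h1 : |ψ x * ((k + 2) * (k + 1) * (T - t) ^ k)| ≤
          (C * decayWeight N q x) * (M * (1 - t / T) ^ r) := by
        rw [abs_mul]
        exact mul_le_mul (hψC x) (hb2' t ht) (abs_nonneg _) (mul_nonneg hC0 (hχ0 x).le)
      have h2 : |μ * (fracLaplacian η ψ x * ((k + 2) * (T - t) ^ (k + 1)))| ≤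
          |μ| * ((C * decayWeight N q x) * (M * (1 - t / T) ^ r)) := by
        rw [abs_mul, abs_mul (fracLaplacian η ψ x)]
        refine mul_le_mul_of_nonneg_left ?_ (abs_nonneg _)
        exact mul_le_mul (hηC x) (hb1' t ht) (abs_nonneg _) (mul_nonneg hC0 (hχ0 x).le)
      rw [abs_mul]
      calc _ ≤ |u t x| * ((C * decayWeight N q x) * (M * (1 - t / T) ^ r) +
            |μ| * ((C * decayWeight N q x) * (M * (1 - t / T) ^ r))) :=
            mul_le_mul_of_nonneg_left ((abs_add_le _ _).trans (add_le_add h1 h2)) (abs_nonneg _)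
        _ = _ := by ring)
  rw [integral_const_mul] at hR1 hR2
  have hp1 := (abs_mul _ _).trans_le (mul_le_mul hc₁ hd₁ (abs_nonneg _) hM0)
  have hp2 := (abs_mul _ _).trans_le (mul_le_mul hc₂ hd₂ (abs_nonneg _) hM0)
  have hp3 := (abs_mul _ _).trans_le (mul_le_mul
    ((abs_mul μ _).trans_le (mul_le_mul_of_nonneg_left hc₃ (abs_nonneg μ))) hd₃ (abs_nonneg _)
    (by positivity))
  have b1 := (le_abs_self _).trans hR1
  have b2 := (le_abs_self _).trans hR2
  have b3 := (neg_le_abs _).trans hp1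
  have b4 := (neg_le_abs _).trans hp2
  have b5 := (neg_le_abs _).trans hp3
  have hx1 : 0 ≤ M * (C * I₀) := by positivity
  have hx2 : 0 ≤ (1 + |μ|) * (M * (C * I₁)) := by positivity
  -- The right side splits into the five bounds just obtained plus the nonnegative surpluses `hx1`
  -- and `hx2`, left over from using one constant for all terms.
  have e : C * (2 + |μ|) * (k + 2) ^ 2 * T ^ (k + 2) * (I + (I₀ + I₁)) =
      C * M * I + C * (1 + |μ|) * M * I + (M * (C * I₀) + |μ| * M * (C * I₀)) + M * (C * I₀)
      + M * (C * I₁) + (1 + |μ|) * (M * (C * I₁)) := by rw [hM]; ring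
  rw [e]
  linarith

end EnergyEstimate

/-- Joint measurability on the whole slab is read off from the weighted integrability by dividing
out the positive weight. -/
theorem IsWeakSolutionOn.aestronglyMeasurable {N : ℕ} {σ η μ γ p T : ℝ}
    {u₀ u₁ : EuclideanSpace ℝ (Fin N) → ℝ} {u : ℝ → EuclideanSpace ℝ (Fin N) → ℝ}
    (hu : IsWeakSolutionOn σ η μ γ p u₀ u₁ T u) :
    AEStronglyMeasurable (fun z : ℝ × EuclideanSpace ℝ (Fin N) => u z.1 z.2)
      (volume.restrict (Ioo 0 T ×ˢ univ)) := by
  have h := hu.integrable_weighted.aestronglyMeasurable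
  have hm : Measurable fun z : ℝ × EuclideanSpace ℝ (Fin N) =>
      ((1 + ‖z.2‖) ^ (-(N : ℝ) - 2 * min η σ))⁻¹ := by fun_prop
  refine (hm.aestronglyMeasurable.mul h).congr (.of_forall fun z => ?_)
  have : 0 < (1 + ‖z.2‖) ^ (-(N : ℝ) - 2 * min η σ) := by positivity
  simp only [Pi.mul_apply]
  rw [inv_mul_cancel_left₀ this.ne']

theorem integral_decayWeight_slab {N : ℕ} {q : ℝ} (hq : (N : ℝ) < q) {T : ℝ} (hT : 0 < T) :
    Integrable (fun z : ℝ × EuclideanSpace ℝ (Fin N) => decayWeight N q z.2)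
      (volume.restrict (Ioo 0 T ×ˢ univ)) ∧
    ∫ z in Ioo 0 T ×ˢ univ, decayWeight N q (z : ℝ × EuclideanSpace ℝ (Fin N)).2 =
      (∫ x, decayWeight N q x) * T := by
  rw [volume_restrict_Ioo_prod_univ]
  refine ⟨(integrable_decayWeight hq).comp_snd _, ?_⟩
  rw [integral_fun_snd]
  simp [Real.volume_real_Ioo_of_le hT.le, mul_comm]

/-- The energy estimate of a weak solution on `(0, T)`, with constants that do not depend on `T`. -/
theorem exists_energy_estimate {N : ℕ} (hN : 1 ≤ N) {σ η γ p q : ℝ} (μ : ℝ) (hp : 1 < p)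
    (hγ : γ < 1) (hσ0 : 0 < σ) (hσ1 : σ ≤ 1) (hη0 : 0 ≤ η) (hη1 : η ≤ 1)
    (hq : AdmissibleDecay N σ η q) {u₀ u₁ : EuclideanSpace ℝ (Fin N) → ℝ}
    (hu₀ : Integrable (fun x => u₀ x * decayWeight N q x))
    (hu₁ : Integrable (fun x => u₁ x * decayWeight N q x)) :
    ∃ β C D : ℝ, 0 ≤ β ∧ 0 ≤ C ∧ 0 ≤ D ∧
      ∀ (T : ℝ) (u : ℝ → EuclideanSpace ℝ (Fin N) → ℝ), 1 ≤ T →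
      IsWeakSolutionOn σ η μ γ p u₀ u₁ T u →
      Integrable (fun z : ℝ × EuclideanSpace ℝ (Fin N) =>
        |u z.1 z.2| ^ p * decayWeight N q z.2) (volume.restrict (Ioo 0 T ×ˢ univ)) →
      ∫ z in Ioo 0 T ×ˢ univ, |u z.1 z.2| ^ p * decayWeight N q z.2 * (1 - z.1 / T) ^ β ≤
        C * T ^ (-(1 - γ)) * ((∫ z in Ioo 0 T ×ˢ univ,
          |u z.1 z.2| * decayWeight N q z.2 * (1 - z.1 / T) ^ (β / p)) + D) := by
  obtain ⟨hNq, hqσ, hqη⟩ := hq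
  have hχ0 := decayWeight_pos hNq
  obtain ⟨ψ, hψ, hψc, hψ0, ⟨c, hc, hcψ⟩, hbd⟩ := exists_test_functions hN hNq
  -- Order 0 is the identity, so this is the upper bound for ψ_n itself.
  obtain ⟨C₀, hC₀, hb₀⟩ := hbd 0 le_rfl zero_le_one (fun h => absurd h (lt_irrefl _))
  obtain ⟨C₁, hC₁, hb₁⟩ := hbd σ hσ0.le hσ1 hqσ
  obtain ⟨C₂, hC₂, hb₂⟩ := hbd η hη0 hη1 hqη
  have hle : ∀ {a b x : ℝ} {y : EuclideanSpace ℝ (Fin N)}, a ≤ b → x ≤ a * decayWeight N q y →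
      x ≤ b * decayWeight N q y := fun h1 h2 =>
    h2.trans (mul_le_mul_of_nonneg_right h1 (hχ0 _).le)
  set C := C₀ + C₁ + C₂ with hC
  have hCn : 0 ≤ C := by positivity
  have hψC : ∀ n x, |ψ n x| ≤ C * decayWeight N q x := fun n x => by
    have := hb₀ n x
    simp only [fracLaplacian, if_true] at this
    exact hle (by linarith) this
  -- This is the condition β/p ≤ k, i.e. k+3-γ ≤ kp. It lets φ'', of order (T-t)^k, be bounded by
  -- the weight (1-t/T)^{β/p}.
  obtain ⟨k, hk⟩ := exists_nat_ge ((2 + (1 - γ)) / (p - 1))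
  rw [div_le_iff₀ (by linarith)] at hk
  set β := ((k + 2 : ℕ) : ℝ) + (1 - γ) with hβ
  have hβ0 : 0 ≤ β := by
    have : (0 : ℝ) ≤ ((k + 2 : ℕ) : ℝ) := by positivity
    linarith
  have hβk : β / p ≤ k := by
    rw [div_le_iff₀ (by linarith), hβ]
    push_cast
    linarith
  set κ := (Real.Gamma (1 - γ))⁻¹ * betaConst (1 - γ) (k + 2) with hκ
  have hκ0 : 0 < κ := mul_pos (inv_pos.2 (Real.Gamma_pos_of_pos (by linarith)))
    (betaConst_pos (by linarith) _)
  set D := (∫ x, |u₀ x| * decayWeight N q x) + ∫ x, |u₁ x| * decayWeight N q x with hD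
  have hD0 : 0 ≤ D := add_nonneg
    (integral_nonneg fun x => mul_nonneg (abs_nonneg _) (hχ0 x).le)
    (integral_nonneg fun x => mul_nonneg (abs_nonneg _) (hχ0 x).le)
  refine ⟨β, (κ * c)⁻¹ * (C * (2 + |μ|) * (k + 2) ^ 2), D, hβ0, by positivity, hD0,
    fun T u hT hu hup => ?_⟩
  have hT0 : 0 < T := by linarith
  have hu1 : Integrable (fun z : ℝ × EuclideanSpace ℝ (Fin N) =>
      |u z.1 z.2| * decayWeight N q z.2) (volume.restrict (Ioo 0 T ×ˢ univ)) := by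
    have h1 := hu.aestronglyMeasurable.norm
    have h2 := (integral_decayWeight_slab hNq hT0).1
    have h3 := hup
    rw [Set.prod_univ] at h1 h2 h3 ⊢
    exact integrableOn_mul_weight (f := fun z : ℝ × EuclideanSpace ℝ (Fin N) => |u z.1 z.2|)
      (fun z => abs_nonneg _) (fun z => (hχ0 z.2).le) hp.le h1 h2 h3
  set I := ∫ z in Ioo 0 T ×ˢ univ, |u z.1 z.2| * decayWeight N q z.2 * (1 - z.1 / T) ^ (β / p)
  set ν : Measure (ℝ × EuclideanSpace ℝ (Fin N)) := volume.restrict (Ioo 0 T ×ˢ univ) with hν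
  set F : ℝ × EuclideanSpace ℝ (Fin N) → ℝ :=
    fun z => |u z.1 z.2| ^ p * decayWeight N q z.2 * (1 - z.1 / T) ^ β with hF
  have hFi : Integrable F ν := by
    have h := hup
    rw [hν, Set.prod_univ] at h ⊢
    exact integrableOn_mul_rpow_one_sub measurable_fst hT0 hβ0 h
  have hIoo : ∀ᵐ z ∂ν, z.1 ∈ Ioo 0 T := by
    filter_upwards [ae_restrict_mem (measurableSet_Ioo.prod MeasurableSet.univ)] with z hz
    exact hz.1
  set R := C * (2 + |μ|) * (k + 2) ^ 2 * T ^ (k + 2) * (I + D) with hR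
  let B : ℕ → Set (ℝ × EuclideanSpace ℝ (Fin N)) := fun n => {z | ‖z.2‖ ≤ 2 ^ n}
  have hBm : ∀ n, MeasurableSet (B n) := fun n =>
    measurableSet_le (by fun_prop) measurable_const
  -- On the ball |x| ≤ 2^n the test function dominates cχ, and outside it the integrand is
  -- nonnegative and is dropped. R does not depend on n, so n → ∞ is harmless.
  have hn : ∀ n, κ * (c * T ^ β) * ∫ z in B n, F z ∂ν ≤ R := by
    intro n
    have hψi := integrable_source_mul hβ0 hNq hup (hψ n).continuous.measurable (hψC n)
    have h1 := hu.source_le hT hγ hNq hu₀ hu₁ hup hu1 (hψ n) (hψc n) hCn (hψC n)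
      (fun x => hle (by linarith) (hb₁ n x)) (fun x => hle (by linarith) (hb₂ n x)) k
      (r := β / p) (by positivity) hβk
    refine le_trans ?_ h1
    rw [mul_assoc]
    refine mul_le_mul_of_nonneg_left ?_ hκ0.le
    rw [← integral_const_mul]
    have hpos : ∀ z : ℝ × EuclideanSpace ℝ (Fin N), z.1 ∈ Ioo 0 T →
        0 ≤ |u z.1 z.2| ^ p * ψ n z.2 * (T - z.1) ^ β := fun z hz =>
      mul_nonneg (mul_nonneg (by positivity) (hψ0 n _))
        (Real.rpow_nonneg (by linarith [hz.2]) _)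
    refine le_trans ?_ (setIntegral_le_integral (s := B n) hψi (hIoo.mono hpos))
    refine setIntegral_mono_on_ae (hFi.const_mul _).integrableOn hψi.integrableOn (hBm n) ?_
    filter_upwards [hIoo] with z hz hzB
    have e : (T - z.1) ^ β = T ^ β * (1 - z.1 / T) ^ β := by
      have h1 : z.1 / T ≤ 1 := (div_le_one hT0).2 hz.2.le
      rw [← Real.mul_rpow hT0.le (by linarith)]
      congr 1; field_simp
    have h2 : 0 ≤ (1 - z.1 / T) ^ β := (rpow_one_sub_div_mem (τ := Prod.fst) hT0 hβ0 hz).1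
    rw [e, hF]
    calc c * T ^ β * (|u z.1 z.2| ^ p * decayWeight N q z.2 * (1 - z.1 / T) ^ β)
        = |u z.1 z.2| ^ p * (c * decayWeight N q z.2) * (T ^ β * (1 - z.1 / T) ^ β) := by ring
      _ ≤ _ := by
        gcongr
        exact hcψ n z.2 hzB
  have hlim : Filter.Tendsto (fun n => κ * (c * T ^ β) * ∫ z in B n, F z ∂ν) Filter.atTop
      (nhds (κ * (c * T ^ β) * ∫ z, F z ∂ν)) := by
    refine Filter.Tendsto.const_mul _ ?_
    have hU : ⋃ n, B n = univ := by
      refine eq_univ_of_forall fun z => mem_iUnion.2 ?_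
      obtain ⟨n, hn⟩ := pow_unbounded_of_one_lt ‖z.2‖ (one_lt_two (α := ℝ))
      exact ⟨n, hn.le⟩
    have hmono : Monotone B := fun m n hmn z hz =>
      le_trans (show ‖z.2‖ ≤ 2 ^ m from hz) (pow_le_pow_right₀ one_le_two hmn)
    have := tendsto_setIntegral_of_monotone (μ := ν) (f := F) hBm hmono hFi.integrableOn
    rwa [hU, setIntegral_univ] at this
  have hfin := le_of_tendsto' hlim hn
  have hTβ : T ^ β = T ^ (k + 2) * T ^ (1 - γ) := by
    rw [hβ, Real.rpow_add hT0, Real.rpow_natCast]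
  have hpos : 0 < κ * (c * T ^ β) := by positivity
  rw [mul_comm, ← le_div_iff₀ hpos] at hfin
  refine hfin.trans (le_of_eq ?_)
  rw [hR, hTβ, Real.rpow_neg hT0.le]
  field_simp

/-! ### Nonexistence of nontrivial global solutions -/

theorem theorem1p1 (N : ℕ) (hN : 1 ≤ N) (σ η μ γ p q : ℝ)
    (hp : 1 < p) (hγ : γ < 1) (hσ0 : 0 < σ) (hσ1 : σ ≤ 1) (hη0 : 0 ≤ η) (hη1 : η ≤ 1)
    (hq : AdmissibleDecay N σ η q)
    (u₀ u₁ : EuclideanSpace ℝ (Fin N) → ℝ)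
    (hu₀ : Integrable (fun x => u₀ x * decayWeight N q x))
    (hu₁ : Integrable (fun x => u₁ x * decayWeight N q x))
    (T : EReal) (hT : 0 < T)
    (u : ℝ → EuclideanSpace ℝ (Fin N) → ℝ)
    (hu : IsWeakSolution σ η μ γ p u₀ u₁ T u)
    (hu_nontrivial : ¬ ∀ᵐ z : ℝ × EuclideanSpace ℝ (Fin N)
      ∂(volume.restrict ({t : ℝ | 0 < t ∧ (t : EReal) < T} ×ˢ univ)), u z.1 z.2 = 0)
    (hu_loc : ∀ T' : ℝ, 0 < T' → (T' : EReal) < T →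
      Integrable (fun z : ℝ × EuclideanSpace ℝ (Fin N) => |u z.1 z.2| ^ p * decayWeight N q z.2)
        (volume.restrict (Ioo 0 T' ×ˢ univ)))
    (hpγ : p * γ ≤ 1) :
    T < ⊤ := by
  by_contra hcon
  obtain rfl : T = ⊤ := top_le_iff.1 (not_lt.1 hcon)
  have hsol := hu.2 rfl
  have hloc : ∀ T' : ℝ, 0 < T' → Integrable (fun z : ℝ × EuclideanSpace ℝ (Fin N) =>
      |u z.1 z.2| ^ p * decayWeight N q z.2) (volume.restrict (Ioo 0 T' ×ˢ univ)) :=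
    fun T' h => hu_loc T' h (EReal.coe_lt_top T')
  have hNq := hq.1
  have hχ0 := decayWeight_pos hNq
  obtain ⟨β, C, D, hβ, hC, hD, hest⟩ :=
    exists_energy_estimate hN μ hp hγ hσ0 hσ1 hη0 hη1 hq hu₀ hu₁
  have hpp : p.HolderConjugate p.conjExponent := Real.HolderConjugate.conjExponent hp
  -- This is the only use of pγ ≤ 1: it is equivalent to γ ≤ 1/p = 1 - 1/p'.
  have hexp : 1 / p.conjExponent ≤ 1 - γ := by
    have h1 := hpp.inv_add_inv_eq_one
    have h2 : γ ≤ p⁻¹ := by rw [← one_div, le_div_iff₀ (by linarith)]; linarith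
    rw [one_div]; linarith
  have hfm : ∀ T : ℝ, 0 < T → AEStronglyMeasurable (fun z : ℝ × EuclideanSpace ℝ (Fin N) =>
      |u z.1 z.2|) (volume.restrict (Prod.fst ⁻¹' Ioo 0 T)) := fun T hT => by
    have h := (hsol T hT).aestronglyMeasurable.norm
    rwa [Set.prod_univ] at h
  have hW : ∀ T : ℝ, 0 < T → IntegrableOn (fun z : ℝ × EuclideanSpace ℝ (Fin N) =>
      decayWeight N q z.2) (Prod.fst ⁻¹' Ioo 0 T) := fun T hT => by
    have h := (integral_decayWeight_slab hNq hT).1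
    rwa [Set.prod_univ] at h
  have hWκ : ∀ T : ℝ, 0 < T →
      ∫ z in Prod.fst ⁻¹' Ioo 0 T, decayWeight N q (z : ℝ × EuclideanSpace ℝ (Fin N)).2 ≤
        (∫ x, decayWeight N q x) * T := fun T hT => by
    have h := (integral_decayWeight_slab hNq hT).2.le
    rwa [Set.prod_univ] at h
  have hfp : ∀ T : ℝ, 0 < T → IntegrableOn (fun z : ℝ × EuclideanSpace ℝ (Fin N) =>
      |u z.1 z.2| ^ p * decayWeight N q z.2) (Prod.fst ⁻¹' Ioo 0 T) := fun T hT => by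
    have h := hloc T hT
    rwa [Set.prod_univ] at h
  have hmain : ∀ T : ℝ, 1 ≤ T →
      ∫ z in Prod.fst ⁻¹' Ioo 0 T, |u z.1 z.2| ^ p * decayWeight N q z.2 * (1 - z.1 / T) ^ β ≤
        C * T ^ (-(1 / p.conjExponent)) * ((∫ z in Prod.fst ⁻¹' Ioo 0 T,
          |u z.1 z.2| * decayWeight N q z.2 * (1 - z.1 / T) ^ (β / p)) + D) := by
    intro T hT
    have hT0 : 0 < T := by linarith
    have h := hest T u hT (hsol T hT0) (hloc T hT0)
    rw [Set.prod_univ] at h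
    refine h.trans ?_
    refine mul_le_mul_of_nonneg_right (mul_le_mul_of_nonneg_left
      (Real.rpow_le_rpow_of_exponent_le hT (by linarith)) hC) (add_nonneg ?_ hD)
    refine setIntegral_nonneg (measurable_fst measurableSet_Ioo) fun z hz => ?_
    exact mul_nonneg (mul_nonneg (abs_nonneg _) (hχ0 _).le)
      (rpow_one_sub_div_mem (τ := Prod.fst) hT0 (by positivity) hz).1
  have hzero : ∀ A : ℝ, 0 < A → ∀ᵐ z : ℝ × EuclideanSpace ℝ (Fin N)
      ∂(volume.restrict (Ioo 0 A ×ˢ univ)), u z.1 z.2 = 0 := by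
    intro A hA
    have h0 := setIntegral_rpow_eq_zero_of_energy_estimate
      (ν := (volume : Measure (ℝ × EuclideanSpace ℝ (Fin N)))) (τ := Prod.fst)
      (f := fun z => |u z.1 z.2|) (W := fun z => decayWeight N q z.2) (β := β) (C := C) (D := D)
      (κ := ∫ x, decayWeight N q x) measurable_fst (fun z => abs_nonneg _)
      (fun z => (hχ0 z.2).le) hpp hβ hC hD (integral_nonneg fun x => (hχ0 x).le)
      hfm hW hWκ hfp hmain hA
    have hnn : 0 ≤ᵐ[volume.restrict (Prod.fst ⁻¹' Ioo 0 A)]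
        fun z : ℝ × EuclideanSpace ℝ (Fin N) => |u z.1 z.2| ^ p * decayWeight N q z.2 :=
      .of_forall fun z => mul_nonneg (Real.rpow_nonneg (abs_nonneg _) p) (hχ0 z.2).le
    rw [setIntegral_eq_zero_iff_of_nonneg_ae hnn (hfp A hA)] at h0
    rw [Set.prod_univ]
    filter_upwards [h0] with z hz
    have hz' : |u z.1 z.2| ^ p * decayWeight N q z.2 = 0 := hz
    rcases mul_eq_zero.1 hz' with h | h
    · exact abs_eq_zero.1 ((Real.rpow_eq_zero (abs_nonneg _) (by linarith)).1 h)
    · exact absurd h (hχ0 z.2).ne'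
  apply hu_nontrivial
  -- Countably many bounded slabs cover all positive times, so the null sets add up to a null set.
  have hU : ({t : ℝ | 0 < t ∧ (t : EReal) < ⊤} ×ˢ univ : Set (ℝ × EuclideanSpace ℝ (Fin N))) =
      ⋃ n : ℕ, Ioo 0 ((n : ℝ) + 1) ×ˢ univ := by
    ext z
    simp only [mem_prod, mem_ofPred_eq, EReal.coe_lt_top, and_true, mem_univ, mem_iUnion, mem_Ioo]
    refine ⟨fun h => ?_, fun ⟨n, h⟩ => h.1⟩
    obtain ⟨n, hn⟩ := exists_nat_gt z.1
    exact ⟨n, h, by linarith⟩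
  rw [hU, ae_restrict_iUnion_iff]
  exact fun n => hzero _ (by positivity)
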